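/- Theorem (Deformed Tree Tensor QNN). Let $n\ge 1$ and let $\sigma_0=I,\sigma_1,\sigma_2,\sigma_3$ be the Pauli matrices, with $\sigma_{(i_1,\dots,i_n)}=\sigma_{i_1}\otimes\cdots\otimes\sigma_{i_n}$. Number the qubits $1,\dots,n$ and let $m=\lceil\log_2 n\rceil$. The $n$-qubit deformed tree tensor circuit is $$V_{\mathrm{DTT}}(\boldsymbol\theta)=V_{m+1}\,CX_m\,V_m\cdots CX_1\,V_1 .$$ Here, for $1\le\ell\le m$, $CX_\ell$ is the product of the (commuting) CNOT gates with target qubit $a=(j-1)2^{\ell}+1$ and control qubit $a+2^{\ell-1}$, over all integers $j\ge 1$ for which $a+2^{\ell-1}\le n$. The layer $V_1$ applies a rotation $e^{-i\theta\sigma_2}$ to every qubit and, for $2\le\ell\le m+1$, $V_\ell$ applies a rotation $e^{-i\theta\sigma_2}$ to every qubit that is the target of a gate of $CX_{\ell-1}$. Each rotation has its own real parameter $\theta$, and $\boldsymbol\theta$ is the vector of all of them ($2n-1$ in number). For a density matrix $\rho_{\mathrm{in}}\in\mathbb C^{2^n\times 2^n}$ (positive semidefinite of trace one) put $$f_{\mathrm{DTT}}(\boldsymbol\theta)=\tfrac12+\tfrac12\operatorname{Tr}\big[\sigma_{(3,0,\dots,0)}\,V_{\mathrm{DTT}}(\boldsymbol\theta)\,\rho_{\mathrm{in}}\,V_{\mathrm{DTT}}(\boldsymbol\theta)^\dagger\big],$$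 $$\alpha(\rho_{\mathrm{in}})=\operatorname{Tr}[\sigma_{(1,0,\dots,0)}\rho_{\mathrm{in}}]^2+\operatorname{Tr}[\sigma_{(3,0,\dots,0)}\rho_{\mathrm{in}}]^2 .$$ Then $f_{\mathrm{DTT}}$ is differentiable, and when the parameters are independent and uniformly distributed in $[0,2\pi]$, $\|\nabla_{\boldsymbol\theta}f_{\mathrm{DTT}}\|^2$ is integrable and $$\frac{1+\log_2 n}{4n}\,\alpha(\rho_{\mathrm{in}})\;\le\;\mathbb E_{\boldsymbol\theta}\|\nabla_{\boldsymbol\theta}f_{\mathrm{DTT}}\|^2\;\le\;2n-1 .$$ -/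

import Mathlib

noncomputable section

namespace DTTQNN

open Matrix MeasureTheory ProbabilityTheory

/-- Operators on `n` qubits: `2 ^ n × 2 ^ n` complex matrices, with rows and columns indexed by
bit strings.  Qubits are numbered `0, …, n - 1`; qubit `0` is the first one. -/
abbrev Operator (n : ℕ) : Type := Matrix (Fin n → Fin 2) (Fin n → Fin 2) ℂ

/-- The Pauli matrices `σ₀ = I`, `σ₁ = X`, `σ₂ = Y`, `σ₃ = Z`. -/
def sigma : Fin 4 → Matrix (Fin 2) (Fin 2) ℂ :=
  ![!![1, 0; 0, 1], !![0, 1; 1, 0], !![0, -Complex.I; Complex.I, 0], !![1, 0; 0, -1]]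

/-- The tensor product `A₀ ⊗ ⋯ ⊗ Aₙ₋₁` of one-qubit operators. -/
def tensor {n : ℕ} (A : Fin n → Matrix (Fin 2) (Fin 2) ℂ) : Operator n :=
  Matrix.of fun x y => ∏ q, A q (x q) (y q)

/-- The Pauli string `σ_(i₀, …, iₙ₋₁)`. -/
def pauliString {n : ℕ} (i : Fin n → Fin 4) : Operator n := tensor fun q => sigma (i q)

/-- The one-qubit operator `A` acting on qubit `q`, tensored with the identity elsewhere. -/
def onQubit {n : ℕ} (q : Fin n) (A : Matrix (Fin 2) (Fin 2) ℂ) : Operator n :=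
  tensor (Function.update (fun _ => 1) q A)

/-- The CNOT gate with control `c` and target `t`:
`|0⟩⟨0|` on `c`, plus `|1⟩⟨1|` on `c` together with `σ₁` on `t`. -/
def cnot {n : ℕ} (c t : Fin n) : Operator n :=
  onQubit c (Matrix.single 0 0 1) + onQubit c (Matrix.single 1 1 1) * onQubit t (sigma 1)

open scoped ComplexOrder in
/-- Quantum states are density matrices: positive semidefinite of trace one. -/
structure IsState {n : ℕ} (ρ : Operator n) : Prop where
  posSemidef : ρ.PosSemidef
  trace_eq_one : ρ.trace = 1

/-- The one-qubit rotation `W = exp (-i θ σ₂)`. -/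
def rotation (θ : ℝ) : Matrix (Fin 2) (Fin 2) ℂ :=
  NormedSpace.exp ((-(Complex.I * (θ : ℂ))) • sigma 2)

/-- The number `⌈log₂ n⌉` of CNOT layers. -/
abbrev depth (n : ℕ) : ℕ := Nat.clog 2 n

/-- Qubit `q` is the target of a CNOT gate in the CNOT layer number `j = 0, 1, …`: it heads a block
of `2 ^ (j + 1)` consecutive qubits, and the qubit `q + 2 ^ j` heading the second half of that
block exists (it is then the control). For `n` not a power of `2` the last block of a layer may be
incomplete; if its second half is empty, nothing happens to it in that layer. -/
def IsTarget (n j : ℕ) (q : Fin n) : Prop := 2 ^ (j + 1) ∣ (q : ℕ) ∧ (q : ℕ) + 2 ^ j < n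

instance (n j : ℕ) : DecidablePred (IsTarget n j) := fun q =>
  inferInstanceAs (Decidable (2 ^ (j + 1) ∣ (q : ℕ) ∧ (q : ℕ) + 2 ^ j < n))

/-- Qubit `q` carries a rotation in the rotation layer number `ℓ = 0, 1, …`: every qubit does so in
layer `0`, and in layer `j + 1` exactly the targets of the CNOT layer `j` that precedes it. -/
def HasRotation (n : ℕ) : ℕ → Fin n → Prop
  | 0, _ => True
  | j + 1, q => IsTarget n j q

instance (n ℓ : ℕ) : DecidablePred (HasRotation n ℓ) := fun q =>
  match ℓ with
  | 0 => inferInstanceAs (Decidable True)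
  | j + 1 => inferInstanceAs (Decidable (IsTarget n j q))

/-- The parameters of the circuit: one angle for each rotation gate, a gate being given by its
layer and its qubit. -/
abbrev Param (n : ℕ) : Type :=
  {p : Fin (depth n + 1) × Fin n // HasRotation n p.1 p.2}

/-- The rotation layer number `ℓ`. -/
def rotationLayer {n : ℕ} (θ : EuclideanSpace ℝ (Param n)) (ℓ : Fin (depth n + 1)) : Operator n :=
  tensor fun q => if h : HasRotation n ℓ q then rotation (θ ⟨(ℓ, q), h⟩) else 1

/-- The CNOT layer number `j`. The gates of a layer act on pairwise disjoint pairs of qubits, so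
that their order does not matter. -/
def cnotLayer (n j : ℕ) : Operator n :=
  (List.ofFn fun q : Fin n =>
    if h : IsTarget n j q then cnot ⟨(q : ℕ) + 2 ^ j, h.2⟩ q else 1).prod

/-- The circuit up to and including the rotation layer `ℓ`. -/
def partialCircuit {n : ℕ} (θ : EuclideanSpace ℝ (Param n)) (ℓ : Fin (depth n + 1)) : Operator n :=
  Fin.induction (motive := fun _ => Operator n) (rotationLayer θ 0)
    (fun j U => rotationLayer θ j.succ * cnotLayer n j * U) ℓ

/-- The whole circuit `V_DTT(θ)`: rotation layers and CNOT layers alternate, beginning and ending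
with a rotation layer. -/
def circuit {n : ℕ} (θ : EuclideanSpace ℝ (Param n)) : Operator n :=
  partialCircuit θ (Fin.last (depth n))

/-- The trace of a product of two Hermitian matrices is real: no information is lost in taking the
real parts in the two definitions that follow. -/
theorem trace_mul_im {n : ℕ} {A B : Operator n} (hA : A.IsHermitian) (hB : B.IsHermitian) :
    (A * B).trace.im = 0 := by
  rw [← Complex.conj_eq_iff_im]
  have h := Matrix.trace_conjTranspose (A * B)
  rw [Matrix.conjTranspose_mul, hA.eq, hB.eq, Matrix.trace_mul_comm] at h
  exact h.symm

/-- `f_DTT(θ) = 1/2 + 1/2 Tr[σ_(3,0,…,0) V_DTT(θ) ρ V_DTT(θ)†]`. -/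
def objective {n : ℕ} [NeZero n] (ρ : Operator n) (θ : EuclideanSpace ℝ (Param n)) : ℝ :=
  1 / 2 + 1 / 2 * (pauliString (Pi.single (0 : Fin n) 3) * (circuit θ * ρ * (circuit θ)ᴴ)).trace.re

/-- `α(ρ) = Tr[σ_(1,0,…,0) ρ]² + Tr[σ_(3,0,…,0) ρ]²`. -/
def alpha {n : ℕ} [NeZero n] (ρ : Operator n) : ℝ :=
  (pauliString (Pi.single (0 : Fin n) 1) * ρ).trace.re ^ 2 +
    (pauliString (Pi.single (0 : Fin n) 3) * ρ).trace.re ^ 2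

/-- The law of the parameters: independent angles, each uniform in `[0, 2π]`. -/
def paramLaw (n : ℕ) : Measure (EuclideanSpace ℝ (Param n)) :=
  (Measure.pi fun _ : Param n => cond volume (Set.Icc 0 (2 * Real.pi))).map (WithLp.toLp 2)

end DTTQNN

end

/-!
In each angle the objective is a sinusoid of period `π`, so its partial derivative is the difference
of two values of the objective, shifted by `± π / 4`. These values lie in `[0, 1]`: the squared
gradient is at most the number of parameters.

For the lower bound keep only the angles of the first qubit, one in each of the `depth n + 1`
rotation layers. Replace the input state by its average over half-period rotations of the other
qubits. This averages the objective over translates of the parameters and hence, by convexity and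
translation invariance, does not increase the second moments of its partial derivatives. On the
averaged state every tensor observable that anticommutes with `σ₂` on another qubit has expectation
zero, and this survives the circuit as long as the observable is trivial on the controls already
used. A CNOT gate aimed at the first qubit turns its `σ₃` into `σ₃ ⊗ σ₃`, whose expectation
therefore vanishes, and fixes its `σ₁`. So each layer after the first multiplies the `σ₁`
coordinate of the first qubit by the cosine of twice the angle, and the objective becomes a product
of functions of independent angles. Each of the partial derivatives kept has second moment
`α(ρ) / 2 ^ (depth n + 1)`.
-/

noncomputable section

namespace DTTQNN

open Matrix MeasureTheory ProbabilityTheory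
open scoped Real

section ParameterShift

variable {ι : Type*} [DecidableEq ι] {f : EuclideanSpace ℝ ι → ℝ}

theorem single_eq_smul (i : ι) (t : ℝ) :
    EuclideanSpace.single i t = t • EuclideanSpace.single i (1 : ℝ) := by
  ext j; simp

/-- A function of several angles that is a sinusoid of period `π` in each angle separately, as are
expectation values of circuits made of rotations `exp (-i θ σ₂)`. -/
def IsSinusoidal (f : EuclideanSpace ℝ ι → ℝ) : Prop :=
  ∀ i θ, ∃ a b c : ℝ, ∀ t,
    f (θ + EuclideanSpace.single i t) = a + b * Real.cos (2 * t) + c * Real.sin (2 * t)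

/-- The finite difference that computes the `i`-th partial derivative of a sinusoidal function
exactly (the parameter-shift rule). -/
def parameterShift (f : EuclideanSpace ℝ ι → ℝ) (i : ι) (θ : EuclideanSpace ℝ ι) : ℝ :=
  f (θ + EuclideanSpace.single i (π / 4)) - f (θ + EuclideanSpace.single i (-(π / 4)))

theorem IsSinusoidal.hasDerivAt_add_single (hf : IsSinusoidal f) (i : ι)
    (θ : EuclideanSpace ℝ ι) :
    HasDerivAt (fun t => f (θ + EuclideanSpace.single i t)) (parameterShift f i θ) 0 := by
  obtain ⟨a, b, c, h⟩ := hf i θ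
  have two_mul : HasDerivAt (fun t : ℝ => 2 * t) 2 0 := by
    simpa using (hasDerivAt_id (0 : ℝ)).const_mul 2
  have pi_div_two : 2 * (π / 4) = π / 2 := by ring
  rw [funext h]
  refine (((two_mul.cos.const_mul b).const_add a).add (two_mul.sin.const_mul c)).congr_deriv ?_
  simp only [parameterShift, h, mul_neg, pi_div_two, Real.cos_neg, Real.sin_neg,
    Real.cos_pi_div_two, Real.sin_pi_div_two, mul_zero, Real.sin_zero, Real.cos_zero]
  ring

theorem IsSinusoidal.periodic (hf : IsSinusoidal f) (i : ι) :
    Function.Periodic f (EuclideanSpace.single i (2 * π)) := fun θ => by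
  obtain ⟨a, b, c, h⟩ := hf i θ
  have h₀ := h 0
  rw [single_eq_smul, zero_smul, add_zero, mul_zero, Real.cos_zero, Real.sin_zero] at h₀
  rw [h, h₀, Real.cos_two_mul, Real.sin_two_mul, Real.cos_two_pi, Real.sin_two_pi]
  ring

theorem periodic_parameterShift {c : EuclideanSpace ℝ ι} (hf : Function.Periodic f c) (i : ι) :
    Function.Periodic (parameterShift f i) c :=
  (hf.add_const _).sub (hf.add_const _)

theorem continuous_parameterShift [Finite ι] (hf : Continuous f) (i : ι) :
    Continuous (parameterShift f i) := by
  have := Fintype.ofFinite ι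
  unfold parameterShift
  fun_prop

theorem parameterShift_of_antiperiodic {i : ι}
    (hf : Function.Antiperiodic f (EuclideanSpace.single i (π / 2))) (θ : EuclideanSpace ℝ ι) :
    parameterShift f i θ = 2 * f (θ + EuclideanSpace.single i (π / 4)) := by
  have h := hf (θ + EuclideanSpace.single i (-(π / 4)))
  rw [add_assoc, ← PiLp.single_add, show -(π / 4) + π / 2 = π / 4 by ring] at h
  rw [parameterShift, ← neg_eq_iff_eq_neg.mpr h]
  ring

section Products

variable {κ : Type*} [Fintype κ] {e : κ → ι} {g : κ → ℝ → ℝ} {c : ℝ}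

theorem periodic_prod_apply (hg : ∀ k, Function.Periodic (g k) c) (i : ι) :
    Function.Periodic (fun θ : EuclideanSpace ℝ ι => ∏ k, g k (θ (e k)))
      (EuclideanSpace.single i c) := fun θ => by
  refine Finset.prod_congr rfl fun k _ => ?_
  obtain hk | hk := eq_or_ne (e k) i
  · rw [PiLp.add_apply, hk, PiLp.single_eq_same, hg k]
  · rw [PiLp.add_apply, PiLp.single_eq_of_ne 2 hk, add_zero]

theorem antiperiodic_prod_apply (he : Function.Injective e) {k : κ}
    (hg : Function.Antiperiodic (g k) c) :
    Function.Antiperiodic (fun θ : EuclideanSpace ℝ ι => ∏ k, g k (θ (e k)))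
      (EuclideanSpace.single (e k) c) := fun θ => by
  classical
  simp only [← Finset.mul_prod_erase _ _ (Finset.mem_univ k)]
  rw [PiLp.add_apply, PiLp.single_eq_same, hg, neg_mul]
  refine congrArg (-(_ * ·)) (Finset.prod_congr rfl fun l hl => ?_)
  rw [PiLp.add_apply, PiLp.single_eq_of_ne 2 (he.ne (Finset.ne_of_mem_erase hl)), add_zero]

end Products

theorem norm_gradient_sq_eq_sum_parameterShift_sq [Fintype ι] (hf : IsSinusoidal f)
    (hd : Differentiable ℝ f) (θ : EuclideanSpace ℝ ι) :
    ‖gradient f θ‖ ^ 2 = ∑ i, parameterShift f i θ ^ 2 := by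
  rw [EuclideanSpace.real_norm_sq_eq]
  refine Finset.sum_congr rfl fun i _ => congrArg (· ^ 2) ?_
  have line : HasDerivAt (fun t : ℝ => θ + EuclideanSpace.single i t)
      (EuclideanSpace.single i (1 : ℝ)) 0 := by
    simpa [← single_eq_smul] using
      ((hasDerivAt_id (0 : ℝ)).smul_const (EuclideanSpace.single i (1 : ℝ))).const_add θ
  have along := (hd (θ + EuclideanSpace.single i 0)).hasFDerivAt.comp_hasDerivAt 0 line
  rw [single_eq_smul, zero_smul, add_zero] at along
  calc gradient f θ i = inner ℝ (gradient f θ) (EuclideanSpace.single i 1) := by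
        rw [EuclideanSpace.inner_single_right]; simp
    _ = fderiv ℝ f θ (EuclideanSpace.single i 1) := inner_gradient_left ..
    _ = parameterShift f i θ := along.unique (hf.hasDerivAt_add_single i θ)

end ParameterShift

section UniformAngles

/-- The uniform distribution on `[0, 2π]`. -/
abbrev uniformAngle : Measure ℝ := cond volume (Set.Icc 0 (2 * π))

theorem volume_Icc_zero_two_pi : volume (Set.Icc 0 (2 * π)) = ENNReal.ofReal (2 * π) := by
  rw [Real.volume_Icc, sub_zero]

instance isProbabilityMeasure_uniformAngle : IsProbabilityMeasure uniformAngle :=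
  cond_isProbabilityMeasure_of_finite
    (by rw [volume_Icc_zero_two_pi]; simp [Real.pi_pos])
    (by rw [volume_Icc_zero_two_pi]; exact ENNReal.ofReal_ne_top)

theorem integral_uniformAngle (g : ℝ → ℝ) :
    ∫ t, g t ∂uniformAngle = (2 * π)⁻¹ * ∫ t in 0..2 * π, g t := by
  rw [uniformAngle, ProbabilityTheory.cond, integral_smul_measure, integral_Icc_eq_integral_Ioc,
    ← intervalIntegral.integral_of_le Real.two_pi_pos.le, volume_Icc_zero_two_pi,
    ENNReal.toReal_inv, ENNReal.toReal_ofReal Real.two_pi_pos.le, smul_eq_mul]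

theorem integral_uniformAngle_sinusoid_sq (x z : ℝ) :
    ∫ t, (Real.cos (2 * t) * x + Real.sin (2 * t) * z) ^ 2 ∂uniformAngle =
      (x ^ 2 + z ^ 2) / 2 := by
  set g : ℝ → ℝ := fun t => (Real.cos (2 * t) * x + Real.sin (2 * t) * z) ^ 2 with hg
  have hgc : Continuous g := by fun_prop
  have periodic : Function.Periodic g (2 * π) := fun t => by
    have four_pi : 2 * (t + 2 * π) = 2 * t + 2 * π + 2 * π := by ring
    simp only [hg, four_pi, Real.cos_add_two_pi, Real.sin_add_two_pi]
  have add_shift : ∀ t, g t + g (t + π / 4) = x ^ 2 + z ^ 2 := fun t => by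
    have quarter : 2 * (t + π / 4) = 2 * t + π / 2 := by ring
    simp only [hg, quarter, Real.cos_add_pi_div_two, Real.sin_add_pi_div_two]
    linear_combination (x ^ 2 + z ^ 2) * Real.sin_sq_add_cos_sq (2 * t)
  have integral_shift : ∫ t in 0..2 * π, g (t + π / 4) = ∫ t in 0..2 * π, g t := by
    rw [intervalIntegral.integral_comp_add_right, zero_add, add_comm (2 * π),
      periodic.intervalIntegral_add_eq (π / 4) 0, zero_add]
  have integral_sum := intervalIntegral.integral_add (μ := volume)
    (hgc.intervalIntegrable 0 (2 * π))
    ((hgc.comp (continuous_add_const (π / 4))).intervalIntegrable 0 (2 * π))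
  simp only [Function.comp_apply, add_shift, integral_shift, intervalIntegral.integral_const,
    sub_zero, smul_eq_mul] at integral_sum
  rw [integral_uniformAngle]
  field_simp
  linarith

theorem measurePreserving_toIocMod_add (s : ℝ) :
    MeasurePreserving (fun t => toIocMod Real.two_pi_pos 0 (t + s)) uniformAngle uniformAngle := by
  have : Fact (0 < 2 * π) := ⟨Real.two_pi_pos⟩
  have uniformAngle_eq : uniformAngle = (volume (Set.Icc 0 (2 * π)))⁻¹ •
      volume.restrict (Set.Ioc 0 (0 + 2 * π)) := by
    rw [uniformAngle, ProbabilityTheory.cond, zero_add, Measure.restrict_congr_set Ioc_ae_eq_Icc]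
  rw [uniformAngle_eq]
  exact ((measurePreserving_subtype_coe measurableSet_Ioc).comp
    ((AddCircle.measurePreserving_equivIoc (2 * π)).comp
      ((measurePreserving_add_right volume (s : AddCircle (2 * π))).comp
        (AddCircle.measurePreserving_mk (2 * π) 0)))).smul_measure _

variable {ι : Type*}

theorem periodic_toLp_zsmul_two_pi [Finite ι] [DecidableEq ι] {f : EuclideanSpace ℝ ι → ℝ}
    (hper : ∀ i, Function.Periodic f (EuclideanSpace.single i (2 * π))) (k : ι → ℤ) :
    Function.Periodic f (WithLp.toLp 2 fun i => k i • (2 * π)) := by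
  have := Fintype.ofFinite ι
  have eq_sum : WithLp.toLp 2 (fun i => k i • (2 * π)) =
      ∑ i, k i • EuclideanSpace.single i (2 * π) := by
    ext j
    simp [Pi.single_apply]
  rw [eq_sum]
  exact Finset.sum_induction _ (Function.Periodic f) (fun _ _ h₁ h₂ => h₁.add_period h₂)
    (fun θ => by rw [add_zero]) fun i _ => (hper i).zsmul (k i)

variable [Fintype ι]

variable (ι) in
/-- The law of a family of independent angles, each uniform in `[0, 2π]`. -/
def uniformAngles : Measure (EuclideanSpace ℝ ι) :=
  (Measure.pi fun _ : ι => uniformAngle).map (WithLp.toLp 2)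

theorem measurePreserving_toLp_uniformAngles :
    MeasurePreserving (WithLp.toLp 2) (Measure.pi fun _ : ι => uniformAngle) (uniformAngles ι) :=
  ⟨WithLp.measurable_toLp 2 _, rfl⟩

instance isProbabilityMeasure_uniformAngles : IsProbabilityMeasure (uniformAngles ι) :=
  Measure.isProbabilityMeasure_map (WithLp.measurable_toLp 2 _).aemeasurable

theorem integral_uniformAngles (f : EuclideanSpace ℝ ι → ℝ) :
    ∫ θ, f θ ∂uniformAngles ι = ∫ x, f (WithLp.toLp 2 x) ∂Measure.pi fun _ : ι => uniformAngle :=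
  (measurePreserving_toLp_uniformAngles.integral_comp
    (MeasurableEquiv.toLp 2 (ι → ℝ)).measurableEmbedding f).symm

theorem integrable_uniformAngles_of_continuous {f : EuclideanSpace ℝ ι → ℝ} (hf : Continuous f) :
    Integrable f (uniformAngles ι) := by
  rw [← measurePreserving_toLp_uniformAngles.integrable_comp_emb
    (MeasurableEquiv.toLp 2 (ι → ℝ)).measurableEmbedding]
  have hg : Continuous (f ∘ WithLp.toLp 2) := hf.comp (PiLp.continuous_toLp 2 _)
  have box_compact : IsCompact (Set.Icc (0 : ι → ℝ) fun _ => 2 * π) := isCompact_Icc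
  obtain ⟨C, hC⟩ := box_compact.exists_bound_of_continuousOn hg.continuousOn
  have mem_box : ∀ᵐ x ∂Measure.pi fun _ : ι => uniformAngle,
      ∀ i, x i ∈ Set.Icc 0 (2 * π) :=
    Filter.eventually_all.mpr fun i => (Measure.tendsto_eval_ae_ae (i := i)).eventually
      (ae_cond_mem measurableSet_Icc)
  refine Integrable.of_bound hg.aestronglyMeasurable C ?_
  filter_upwards [mem_box] with x hx
  exact hC x ⟨fun i => (hx i).1, fun i => (hx i).2⟩

theorem integral_uniformAngles_prod {κ : Type*} [Fintype κ] {e : κ → ι}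
    (he : Function.Injective e) {g : κ → ℝ → ℝ} (hg : ∀ k, Continuous (g k)) :
    ∫ θ, ∏ k, g k (θ (e k)) ∂uniformAngles ι = ∏ k, ∫ t, g k t ∂uniformAngle := by
  rw [integral_uniformAngles]
  have indep : iIndepFun (fun k (x : ι → ℝ) => x (e k)) (Measure.pi fun _ => uniformAngle) :=
    (iIndepFun_pi (X := fun _ => id) fun _ => aemeasurable_id).precomp he
  calc ∫ x : ι → ℝ, ∏ k, g k (x (e k)) ∂Measure.pi (fun _ => uniformAngle)
      = ∏ k, ∫ x : ι → ℝ, g k (x (e k)) ∂Measure.pi (fun _ => uniformAngle) :=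
        indep.integral_fun_prod_comp (fun k => (measurable_pi_apply _).aemeasurable)
          fun k => (hg k).aestronglyMeasurable
    _ = ∏ k, ∫ t, g k t ∂uniformAngle := Finset.prod_congr rfl fun k _ =>
        integral_comp_eval (hg k).aestronglyMeasurable

variable [DecidableEq ι] {f : EuclideanSpace ℝ ι → ℝ}

theorem integral_uniformAngles_add (hf : Continuous f)
    (hper : ∀ i, Function.Periodic f (EuclideanSpace.single i (2 * π)))
    (c : EuclideanSpace ℝ ι) :
    ∫ θ, f (θ + c) ∂uniformAngles ι = ∫ θ, f θ ∂uniformAngles ι := by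
  have wrap : ∀ x : ι → ℝ, f (WithLp.toLp 2 x + c) =
      f (WithLp.toLp 2 fun i => toIocMod Real.two_pi_pos 0 (x i + c i)) := fun x => by
    refine .trans (congrArg f ?_)
      (periodic_toLp_zsmul_two_pi hper (fun i => toIocDiv Real.two_pi_pos 0 (x i + c i)) _)
    ext i
    exact (toIocMod_add_toIocDiv_zsmul Real.two_pi_pos 0 (x i + c i)).symm
  have preserving := measurePreserving_pi (fun _ : ι => uniformAngle) (fun _ => uniformAngle)
    fun i => measurePreserving_toIocMod_add (c i)
  have hg : Continuous fun x : ι → ℝ => f (WithLp.toLp 2 x) := hf.comp (PiLp.continuous_toLp 2 _)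
  simp only [integral_uniformAngles, wrap]
  conv_rhs => rw [← preserving.map_eq]
  exact (integral_map preserving.measurable.aemeasurable hg.aestronglyMeasurable).symm

theorem integral_sq_average_translates_le {κ : Type*} [Fintype κ] [Nonempty κ] (hf : Continuous f)
    (hper : ∀ i, Function.Periodic f (EuclideanSpace.single i (2 * π)))
    (v : κ → EuclideanSpace ℝ ι) :
    ∫ θ, ((∑ k, f (θ + v k)) / Fintype.card κ) ^ 2 ∂uniformAngles ι ≤
      ∫ θ, f θ ^ 2 ∂uniformAngles ι := by
  have integrable_sq : ∀ k, Integrable (fun θ => f (θ + v k) ^ 2) (uniformAngles ι) := fun k =>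
    integrable_uniformAngles_of_continuous (by fun_prop)
  calc ∫ θ, ((∑ k, f (θ + v k)) / Fintype.card κ) ^ 2 ∂uniformAngles ι
      ≤ ∫ θ, (∑ k, f (θ + v k) ^ 2) / Fintype.card κ ∂uniformAngles ι :=
        integral_mono (integrable_uniformAngles_of_continuous (by fun_prop))
          ((integrable_finsetSum _ fun k _ => integrable_sq k).div_const _)
          fun θ => sum_div_card_sq_le_sum_sq_div_card
    _ = (∑ _k : κ, ∫ θ, f θ ^ 2 ∂uniformAngles ι) / Fintype.card κ := by
        rw [integral_div, integral_finsetSum _ fun k _ => integrable_sq k]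
        simp only [integral_uniformAngles_add (f := fun θ => f θ ^ 2) (hf.pow 2) fun i θ =>
          congrArg (· ^ 2) (hper i θ)]
    _ = ∫ θ, f θ ^ 2 ∂uniformAngles ι := by
        rw [Finset.sum_const, Finset.card_univ, nsmul_eq_mul,
          mul_div_cancel_left₀ _ (Nat.cast_ne_zero.mpr Fintype.card_ne_zero)]

end UniformAngles

section Evolution

variable {m : Type*} [Fintype m]

/-- The evolution `ρ ↦ U ρ U†` of a state under an operator. -/
def evolve (U ρ : Matrix m m ℂ) : Matrix m m ℂ := U * ρ * Uᴴ

/-- The expectation value `Re Tr[A ρ]`, a real-bilinear form. -/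
def expectation : Matrix m m ℂ →ₗ[ℝ] Matrix m m ℂ →ₗ[ℝ] ℝ :=
  (LinearMap.mul ℝ _).compr₂ (Complex.reLm ∘ₗ Matrix.traceLinearMap m ℝ ℂ)

theorem expectation_apply (A ρ : Matrix m m ℂ) : expectation A ρ = (A * ρ).trace.re := rfl

theorem evolve_mul (U V ρ : Matrix m m ℂ) : evolve (U * V) ρ = evolve U (evolve V ρ) := by
  simp only [evolve, conjTranspose_mul, Matrix.mul_assoc]

theorem expectation_evolve (A U ρ : Matrix m m ℂ) :
    expectation A (evolve U ρ) = expectation (evolve Uᴴ A) ρ := by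
  simp only [expectation_apply, evolve, conjTranspose_conjTranspose]
  rw [← Matrix.mul_assoc, ← Matrix.mul_assoc, Matrix.trace_mul_comm]
  simp only [Matrix.mul_assoc]

open scoped ComplexOrder in
theorem expectation_conjTranspose_mul_self_nonneg {ρ : Matrix m m ℂ} (hρ : ρ.PosSemidef)
    (P : Matrix m m ℂ) : 0 ≤ expectation (Pᴴ * P) ρ := by
  rw [expectation_apply, Matrix.mul_assoc, Matrix.trace_mul_comm]
  exact (Complex.le_def.mp (hρ.mul_mul_conjTranspose_same P).trace_nonneg).1

theorem exists_expectation_evolve_eq_sinusoid (C ρ A B : Matrix m m ℂ) :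
    ∃ a b c : ℝ, ∀ t : ℝ, expectation C (evolve (Real.cos t • A + Real.sin t • B) ρ) =
      a + b * Real.cos (2 * t) + c * Real.sin (2 * t) := by
  let g : Matrix m m ℂ → Matrix m m ℂ → ℝ := fun M N => expectation C (M * ρ * Nᴴ)
  refine ⟨(g A A + g B B) / 2, (g A A - g B B) / 2, (g A B + g B A) / 2, fun t => ?_⟩
  have expand : expectation C (evolve (Real.cos t • A + Real.sin t • B) ρ) =
      Real.cos t ^ 2 * g A A + Real.cos t * Real.sin t * (g A B + g B A) +
        Real.sin t ^ 2 * g B B := by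
    simp only [evolve, conjTranspose_add, conjTranspose_smul, star_trivial, Matrix.add_mul,
      Matrix.mul_add, Matrix.smul_mul, Matrix.mul_smul, map_add, map_smul, smul_eq_mul, g]
    ring
  rw [expand, Real.cos_two_mul, Real.sin_two_mul]
  linear_combination g B B * Real.sin_sq_add_cos_sq t

end Evolution

section Tensor

variable {n : ℕ}

/-- The tensor product of one-qubit operators as a multilinear map. -/
def tensorMultilinear (n : ℕ) :
    MultilinearMap ℂ (fun _ : Fin n => Matrix (Fin 2) (Fin 2) ℂ) (Operator n) :=
  MultilinearMap.pi fun x => MultilinearMap.pi fun y =>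
    (MultilinearMap.mkPiAlgebra ℂ (Fin n) ℂ).compLinearMap fun q =>
      Matrix.entryLinearMap ℂ ℂ (x q) (y q)

theorem tensorMultilinear_apply (A : Fin n → Matrix (Fin 2) (Fin 2) ℂ) :
    tensorMultilinear n A = tensor A := rfl

theorem tensor_mul (A B : Fin n → Matrix (Fin 2) (Fin 2) ℂ) :
    tensor A * tensor B = tensor fun q => A q * B q := by
  ext x y
  simp only [Matrix.mul_apply, tensor, Matrix.of_apply, Finset.prod_univ_sum,
    Fintype.piFinset_univ, Finset.prod_mul_distrib]

theorem tensor_one : tensor (fun _ : Fin n => 1) = 1 := by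
  ext x y
  simp [tensor, Matrix.one_apply, Finset.prod_ite_zero, funext_iff]

theorem conjTranspose_tensor (A : Fin n → Matrix (Fin 2) (Fin 2) ℂ) :
    (tensor A)ᴴ = tensor fun q => (A q)ᴴ := by
  ext x y
  simp [tensor, Matrix.conjTranspose_apply]

theorem evolve_tensor (W A : Fin n → Matrix (Fin 2) (Fin 2) ℂ) :
    evolve (tensor W)ᴴ (tensor A) = tensor fun q => evolve (W q)ᴴ (A q) := by
  simp only [evolve, conjTranspose_tensor, tensor_mul]

/-- `onQubit q` as a homomorphism of star algebras. -/
def onQubitHom (q : Fin n) : Matrix (Fin 2) (Fin 2) ℂ →⋆ₐ[ℂ] Operator n where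
  toFun := onQubit q
  map_one' := by rw [onQubit, Function.update_eq_self, tensor_one]
  map_zero' := (tensorMultilinear n).map_update_zero _ q
  map_add' A B := (tensorMultilinear n).map_update_add _ q A B
  map_mul' A B := by
    rw [onQubit, onQubit, onQubit, tensor_mul]
    congr 1
    funext p
    obtain rfl | hp := eq_or_ne p q <;> simp [*]
  commutes' c := by
    rw [Algebra.algebraMap_eq_smul_one, Algebra.algebraMap_eq_smul_one, onQubit,
      ← tensorMultilinear_apply, MultilinearMap.map_update_smul, Function.update_eq_self,
      tensorMultilinear_apply, tensor_one]
  map_star' A := by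
    rw [star_eq_conjTranspose, star_eq_conjTranspose, onQubit, onQubit, conjTranspose_tensor]
    congr 1
    funext p
    obtain rfl | hp := eq_or_ne p q <;> simp [*]

end Tensor

section Pauli

theorem sigma_zero : sigma 0 = 1 := Matrix.one_fin_two.symm

theorem sigma_one_mul_self : sigma 1 * sigma 1 = 1 := by
  simp [sigma, Matrix.one_fin_two]

theorem sigma_one_mul_sigma_three_mul_sigma_one : sigma 1 * sigma 3 * sigma 1 = -sigma 3 := by
  simp [sigma]

theorem isHermitian_sigma (i : Fin 4) : (sigma i).IsHermitian := by
  ext a b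
  fin_cases i <;> fin_cases a <;> fin_cases b <;> simp [sigma]

theorem single_zero_add_single_one :
    (Matrix.single 0 0 1 + Matrix.single 1 1 1 : Matrix (Fin 2) (Fin 2) ℂ) = 1 := by
  ext a b; fin_cases a <;> fin_cases b <;> simp [Matrix.single]

theorem single_zero_sub_single_one :
    (Matrix.single 0 0 1 - Matrix.single 1 1 1 : Matrix (Fin 2) (Fin 2) ℂ) = sigma 3 := by
  ext a b; fin_cases a <;> fin_cases b <;> simp [Matrix.single, sigma]

/-- The rotation `-i σ₂ = exp (-i (π / 2) σ₂)`, a square root of `-1`. -/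
def quarterTurn : Matrix (Fin 2) (Fin 2) ℂ := !![0, -1; 1, 0]

theorem quarterTurn_eq_smul_sigma_two : quarterTurn = (-Complex.I) • sigma 2 := by
  simp [quarterTurn, sigma]

theorem quarterTurn_mul_self : quarterTurn * quarterTurn = -1 := by
  simp [quarterTurn, Matrix.one_fin_two]

theorem sigma_one_mul_quarterTurn : sigma 1 * quarterTurn = sigma 3 := by
  simp [quarterTurn, sigma]

theorem rotation_eq_cos_add_sin (θ : ℝ) :
    rotation θ = Real.cos θ • (1 : Matrix (Fin 2) (Fin 2) ℂ) + Real.sin θ • quarterTurn := by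
  let _ : NormedRing (Matrix (Fin 2) (Fin 2) ℂ) := Matrix.linftyOpNormedRing
  let F : ℂ →ₐ[ℝ] Matrix (Fin 2) (Fin 2) ℂ := Complex.liftAux quarterTurn quarterTurn_mul_self
  have F_apply (z : ℂ) : F z = z.re • 1 + z.im • quarterTurn := by
    rw [Complex.liftAux_apply, Algebra.algebraMap_eq_smul_one]
  have generator : (-(Complex.I * (θ : ℂ))) • sigma 2 = F (θ * Complex.I) := by
    simp [F_apply, quarterTurn_eq_smul_sigma_two, ← Complex.coe_smul, smul_smul, mul_comm]
  have exp_F : rotation θ = F (NormedSpace.exp (θ * Complex.I)) := by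
    rw [rotation, generator]
    exact (NormedSpace.map_exp F F.toLinearMap.continuous_of_finiteDimensional _).symm
  rw [exp_F, F_apply, ← Complex.exp_eq_exp_ℂ, Complex.exp_ofReal_mul_I_re,
    Complex.exp_ofReal_mul_I_im]

theorem rotation_add (s t : ℝ) : rotation (s + t) = rotation s * rotation t := by
  rw [rotation, rotation, rotation, ← Matrix.exp_add_of_commute]
  · rw [← add_smul]; push_cast; ring_nf
  · exact ((Commute.refl _).smul_left _).smul_right _

theorem rotation_zero : rotation 0 = 1 := by
  simp [rotation_eq_cos_add_sin]

theorem rotation_pi : rotation π = -1 := by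
  simp [rotation_eq_cos_add_sin]

theorem conjTranspose_rotation (θ : ℝ) : (rotation θ)ᴴ = rotation (-θ) := by
  rw [rotation, rotation, ← Matrix.exp_conjTranspose, conjTranspose_smul, (isHermitian_sigma 2).eq]
  simp

theorem rotation_mem_unitaryGroup (θ : ℝ) : rotation θ ∈ Matrix.unitaryGroup (Fin 2) ℂ := by
  rw [Matrix.mem_unitaryGroup_iff', star_eq_conjTranspose, conjTranspose_rotation, ← rotation_add,
    neg_add_cancel, rotation_zero]

/-- The one-qubit operator `A` anticommutes with `σ₂`. -/
def AntiY (A : Matrix (Fin 2) (Fin 2) ℂ) : Prop := quarterTurn * A = -(A * quarterTurn)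

theorem not_antiY_one : ¬ AntiY 1 := fun h => by
  have entry := congr_fun (congr_fun h 0) 1
  norm_num [quarterTurn] at entry

theorem antiY_sigma_one : AntiY (sigma 1) := by
  simp [AntiY, quarterTurn, sigma]

theorem antiY_sigma_three : AntiY (sigma 3) := by
  simp [AntiY, quarterTurn, sigma]

variable {A B : Matrix (Fin 2) (Fin 2) ℂ}

theorem AntiY.mul_of_commute (hA : AntiY A) (hB : Commute quarterTurn B) : AntiY (A * B) := by
  rw [AntiY, ← Matrix.mul_assoc, hA, Matrix.neg_mul, Matrix.mul_assoc, hB.eq, Matrix.mul_assoc]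

theorem AntiY.commute_mul (hA : AntiY A) (hB : AntiY B) : Commute quarterTurn (A * B) := by
  rw [Commute, SemiconjBy, ← Matrix.mul_assoc, hA, Matrix.neg_mul, Matrix.mul_assoc, hB,
    Matrix.mul_neg, neg_neg, Matrix.mul_assoc]

theorem AntiY.sigma_one_conj (hA : AntiY A) : AntiY (sigma 1 * A * sigma 1) := by
  rw [Matrix.mul_assoc]
  exact antiY_sigma_one.mul_of_commute (hA.commute_mul antiY_sigma_one)

theorem commute_quarterTurn_rotation (φ : ℝ) : Commute quarterTurn (rotation φ) := by
  rw [rotation_eq_cos_add_sin]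
  exact ((Commute.one_right _).smul_right _).add_right ((Commute.refl _).smul_right _)

theorem AntiY.evolve_rotation (hA : AntiY A) (θ : ℝ) :
    evolve (rotation θ)ᴴ A = A * rotation (2 * θ) := by
  have swap : rotation (-θ) * A = A * rotation θ := by
    have hA' : quarterTurn * A = -(A * quarterTurn) := hA
    simp only [rotation_eq_cos_add_sin, Real.cos_neg, Real.sin_neg, Matrix.add_mul, Matrix.mul_add,
      Matrix.smul_mul, Matrix.mul_smul, Matrix.one_mul, Matrix.mul_one, hA', neg_smul_neg]
  rw [evolve, conjTranspose_conjTranspose, conjTranspose_rotation, swap, Matrix.mul_assoc,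
    ← rotation_add, two_mul]

theorem evolve_rotation_sigma_one (θ : ℝ) : evolve (rotation θ)ᴴ (sigma 1) =
    Real.cos (2 * θ) • sigma 1 + Real.sin (2 * θ) • sigma 3 := by
  rw [antiY_sigma_one.evolve_rotation, rotation_eq_cos_add_sin, Matrix.mul_add, Matrix.mul_smul,
    Matrix.mul_smul, Matrix.mul_one, sigma_one_mul_quarterTurn]

end Pauli

section Gates

variable {n : ℕ}

theorem onQubitHom_apply (q : Fin n) (A : Matrix (Fin 2) (Fin 2) ℂ) :
    onQubitHom q A = onQubit q A := rfl

theorem onQubit_one (q : Fin n) : onQubit q 1 = 1 := map_one (onQubitHom q)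

theorem onQubit_smul_add_smul (q : Fin n) (a b : ℝ) (A B : Matrix (Fin 2) (Fin 2) ℂ) :
    onQubit q (a • A + b • B) = a • onQubit q A + b • onQubit q B := by
  simp only [← onQubitHom_apply, ← Complex.coe_smul, map_add, map_smul]

theorem pauliString_single [NeZero n] (i : Fin 4) :
    pauliString (Pi.single (0 : Fin n) i) = onQubit 0 (sigma i) :=
  congrArg tensor <| funext fun q => by
    obtain rfl | hq := eq_or_ne q 0 <;> simp [*, sigma_zero]

theorem tensor_mem_unitaryGroup {W : Fin n → Matrix (Fin 2) (Fin 2) ℂ}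
    (hW : ∀ q, W q ∈ Matrix.unitaryGroup (Fin 2) ℂ) :
    tensor W ∈ Matrix.unitaryGroup (Fin n → Fin 2) ℂ := by
  simp only [Matrix.mem_unitaryGroup_iff, star_eq_conjTranspose] at hW ⊢
  simp only [conjTranspose_tensor, tensor_mul, hW, tensor_one]

theorem evolve_tensor_onQubit {W : Fin n → Matrix (Fin 2) (Fin 2) ℂ}
    (hW : ∀ q, W q ∈ Matrix.unitaryGroup (Fin 2) ℂ) (q : Fin n) (A : Matrix (Fin 2) (Fin 2) ℂ) :
    evolve (tensor W)ᴴ (onQubit q A) = onQubit q (evolve (W q)ᴴ A) := by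
  simp only [Matrix.mem_unitaryGroup_iff', star_eq_conjTranspose] at hW
  rw [onQubit, evolve_tensor, onQubit]
  congr 1
  funext p
  obtain rfl | hp := eq_or_ne p q <;> simp [evolve, *]

theorem commute_onQubit {q r : Fin n} (h : q ≠ r) (A B : Matrix (Fin 2) (Fin 2) ℂ) :
    Commute (onQubit q A) (onQubit r B) := by
  rw [Commute, SemiconjBy, onQubit, onQubit, tensor_mul, tensor_mul]
  exact congrArg tensor
    (Pi.mulSingle_commute (f := fun _ : Fin n => Matrix (Fin 2) (Fin 2) ℂ) h A B).eq

theorem onQubit_mul_tensor (q : Fin n) (B : Matrix (Fin 2) (Fin 2) ℂ)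
    (A : Fin n → Matrix (Fin 2) (Fin 2) ℂ) :
    onQubit q B * tensor A = tensor (Function.update A q (B * A q)) := by
  rw [onQubit, tensor_mul]
  congr 1
  funext p
  obtain rfl | hp := eq_or_ne p q <;> simp [*]

theorem tensor_mul_onQubit (A : Fin n → Matrix (Fin 2) (Fin 2) ℂ) (q : Fin n)
    (B : Matrix (Fin 2) (Fin 2) ℂ) :
    tensor A * onQubit q B = tensor (Function.update A q (A q * B)) := by
  rw [onQubit, tensor_mul]
  congr 1
  funext p
  obtain rfl | hp := eq_or_ne p q <;> simp [*]

theorem tensor_update_zero (A : Fin n → Matrix (Fin 2) (Fin 2) ℂ) (q : Fin n) :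
    tensor (Function.update A q 0) = 0 :=
  (tensorMultilinear n).map_update_zero A q

theorem isHermitian_cnot {c t : Fin n} (hct : c ≠ t) : (cnot c t).IsHermitian := by
  have hermitian {A : Matrix (Fin 2) (Fin 2) ℂ} (hA : A.IsHermitian) (q : Fin n) :
      IsSelfAdjoint (onQubit q A) := IsSelfAdjoint.map hA (onQubitHom q)
  have projector (b : Fin 2) : (Matrix.single b b (1 : ℂ)).IsHermitian := by
    simp [Matrix.IsHermitian]
  exact (hermitian (projector 0) c).add
    (((hermitian (projector 1) c).commute_iff (hermitian (isHermitian_sigma 1) t)).mp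
      (commute_onQubit hct _ _))

theorem evolve_cnot_tensor {c t : Fin n} (hct : c ≠ t) {A : Fin n → Matrix (Fin 2) (Fin 2) ℂ}
    (hA : A c = 1) :
    evolve (cnot c t)ᴴ (tensor A) = tensor (Function.update A c (Matrix.single 0 0 1)) +
      tensor (Function.update (Function.update A t (sigma 1 * A t * sigma 1)) c
        (Matrix.single 1 1 1)) := by
  have left : cnot c t * tensor A = tensor (Function.update A c (Matrix.single 0 0 1)) +
      tensor (Function.update (Function.update A t (sigma 1 * A t)) c (Matrix.single 1 1 1)) := by
    simp only [cnot, Matrix.add_mul, Matrix.mul_assoc, onQubit_mul_tensor,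
      Function.update_of_ne hct, hA, Matrix.mul_one]
  rw [evolve, conjTranspose_conjTranspose, (isHermitian_cnot hct).eq, left, cnot]
  simp [Matrix.add_mul, Matrix.mul_add, ← Matrix.mul_assoc, tensor_mul_onQubit,
    tensor_update_zero, Function.update_of_ne hct.symm,
    Function.update_comm hct]

theorem evolve_cnot_tensor_of_commute {c t : Fin n} (hct : c ≠ t)
    {A : Fin n → Matrix (Fin 2) (Fin 2) ℂ} (hA : A c = 1) (ht : sigma 1 * A t * sigma 1 = A t) :
    evolve (cnot c t)ᴴ (tensor A) = tensor A := by
  rw [evolve_cnot_tensor hct hA, ht, Function.update_eq_self]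
  simp only [← tensorMultilinear_apply]
  rw [← MultilinearMap.map_update_add, single_zero_add_single_one, ← hA, Function.update_eq_self]

theorem evolve_cnot_tensor_of_anticommute {c t : Fin n} (hct : c ≠ t)
    {A : Fin n → Matrix (Fin 2) (Fin 2) ℂ} (hA : A c = 1) (ht : sigma 1 * A t * sigma 1 = -A t) :
    evolve (cnot c t)ᴴ (tensor A) = tensor (Function.update A c (sigma 3)) := by
  rw [evolve_cnot_tensor hct hA, ht, Function.update_comm hct.symm]
  simp only [← tensorMultilinear_apply]
  rw [MultilinearMap.map_update_neg, Function.update_comm hct, Function.update_eq_self,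
    ← sub_eq_add_neg, ← MultilinearMap.map_update_sub, single_zero_sub_single_one]

theorem cnot_mem_unitaryGroup {c t : Fin n} (hct : c ≠ t) :
    cnot c t ∈ Matrix.unitaryGroup (Fin n → Fin 2) ℂ := by
  have fixed := evolve_cnot_tensor_of_commute (A := fun _ => 1) hct rfl
    (by rw [Matrix.mul_one, sigma_one_mul_self])
  rw [Matrix.mem_unitaryGroup_iff', star_eq_conjTranspose]
  rwa [tensor_one, evolve, conjTranspose_conjTranspose, Matrix.mul_one] at fixed

end Gates

section Bloch

variable {n : ℕ} [NeZero n]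

/-- The coordinate of the Bloch vector of the first qubit along `σ₁`. -/
def blochX : Operator n →ₗ[ℝ] ℝ := expectation (onQubit 0 (sigma 1))

/-- The coordinate of the Bloch vector of the first qubit along `σ₃`. -/
def blochZ : Operator n →ₗ[ℝ] ℝ := expectation (onQubit 0 (sigma 3))

theorem alpha_eq_blochX_sq_add_blochZ_sq (ρ : Operator n) :
    alpha ρ = blochX ρ ^ 2 + blochZ ρ ^ 2 := by
  rw [alpha, pauliString_single, pauliString_single, blochX, blochZ, expectation_apply,
    expectation_apply]

theorem objective_eq_blochZ (ρ : Operator n) (θ : EuclideanSpace ℝ (Param n)) :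
    objective ρ θ = 1 / 2 + 1 / 2 * blochZ (evolve (circuit θ) ρ) := by
  rw [objective, pauliString_single, blochZ, expectation_apply, evolve]

theorem blochX_evolve_rotation (φ : Fin n → ℝ) (ρ : Operator n) :
    blochX (evolve (tensor fun q => rotation (φ q)) ρ) =
      Real.cos (2 * φ 0) * blochX ρ + Real.sin (2 * φ 0) * blochZ ρ := by
  rw [blochX, blochZ, expectation_evolve,
    evolve_tensor_onQubit fun q => rotation_mem_unitaryGroup _, evolve_rotation_sigma_one,
    onQubit_smul_add_smul]
  simp only [map_add, map_smul, LinearMap.add_apply, LinearMap.smul_apply, smul_eq_mul]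

end Bloch

section TwirledStates

variable {n : ℕ}

/-- The product of a sequence of CNOT gates, given by their controls and targets. -/
def cnots (gates : List (Fin n × Fin n)) : Operator n := (gates.map fun g => cnot g.1 g.2).prod

theorem cnots_cons (g : Fin n × Fin n) (gates : List (Fin n × Fin n)) :
    cnots (g :: gates) = cnot g.1 g.2 * cnots gates := List.prod_cons

theorem evolve_cnot_onQubit {c t q : Fin n} {A : Matrix (Fin 2) (Fin 2) ℂ} (hct : c ≠ t)
    (hcq : c ≠ q) (hA : t = q → sigma 1 * A * sigma 1 = A) :
    evolve (cnot c t)ᴴ (onQubit q A) = onQubit q A := by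
  refine evolve_cnot_tensor_of_commute hct (Function.update_of_ne hcq ..) ?_
  obtain rfl | htq := eq_or_ne t q
  · rw [Function.update_self, hA rfl]
  · rw [Function.update_of_ne htq, Matrix.mul_one, sigma_one_mul_self]

variable [NeZero n]

/-- No tensor observable that is trivial on the qubits in `V` and anticommutes with `σ₂` on some
qubit other than the first has an expectation in the state `ρ`. Averaging a state over half-period
translates of the first rotations produces this for `V = ∅`; in later layers `V` collects the
controls of the CNOT gates already applied. -/
def IsTwirled (V : Set (Fin n)) (ρ : Operator n) : Prop :=
  ∀ A : Fin n → Matrix (Fin 2) (Fin 2) ℂ, (∀ q ∈ V, A q = 1) → ∀ q ≠ 0, AntiY (A q) →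
    expectation (tensor A) ρ = 0

variable {V : Set (Fin n)} {ρ : Operator n}

theorem IsTwirled.mono (hρ : IsTwirled V ρ) {V' : Set (Fin n)} (h : V ⊆ V') : IsTwirled V' ρ :=
  fun A hA => hρ A fun q hq => hA q (h hq)

theorem IsTwirled.evolve_rotation (hρ : IsTwirled V ρ) (φ : Fin n → ℝ) :
    IsTwirled V (evolve (tensor fun q => rotation (φ q)) ρ) := fun A hA q hq hAq => by
  rw [expectation_evolve, evolve_tensor]
  refine hρ _ (fun r hr => ?_) q hq ?_
  · have unitary := Matrix.mem_unitaryGroup_iff'.mp (rotation_mem_unitaryGroup (φ r))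
    rwa [hA r hr, evolve, Matrix.mul_one, conjTranspose_conjTranspose]
  · rw [hAq.evolve_rotation]
    exact hAq.mul_of_commute (commute_quarterTurn_rotation _)

theorem IsTwirled.evolve_cnot (hρ : IsTwirled V ρ) {c t : Fin n} (hct : c ≠ t) (hc : c ∉ V) :
    IsTwirled (insert c V) (evolve (cnot c t) ρ) := fun A hA q hq hAq => by
  have hAc : A c = 1 := hA c (Set.mem_insert c V)
  have hqc : q ≠ c := by rintro rfl; exact not_antiY_one (hAc ▸ hAq)
  have ne_c {r : Fin n} (hr : r ∈ V) : r ≠ c := fun h => hc (h ▸ hr)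
  have trivial_on_V {r : Fin n} (hr : r ∈ V) : A r = 1 := hA r (Set.mem_insert_of_mem c hr)
  rw [expectation_evolve, evolve_cnot_tensor hct hAc, map_add, LinearMap.add_apply,
    hρ _ (fun r hr => ?_) q hq (by rwa [Function.update_of_ne hqc]),
    hρ _ (fun r hr => ?_) q hq ?_, add_zero]
  · rw [Function.update_of_ne hqc]
    obtain rfl | hqt := eq_or_ne q t
    · simpa using hAq.sigma_one_conj
    · rwa [Function.update_of_ne hqt]
  · rw [Function.update_of_ne (ne_c hr)]
    obtain rfl | hrt := eq_or_ne r t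
    · rw [Function.update_self, trivial_on_V hr, Matrix.mul_one, sigma_one_mul_self]
    · rw [Function.update_of_ne hrt, trivial_on_V hr]
  · rw [Function.update_of_ne (ne_c hr), trivial_on_V hr]

theorem IsTwirled.evolve_cnots (hρ : IsTwirled V ρ) {gates : List (Fin n × Fin n)}
    (hne : ∀ g ∈ gates, g.1 ≠ g.2) (hV : ∀ g ∈ gates, g.1 ∉ V)
    (hnodup : (gates.map Prod.fst).Nodup) :
    IsTwirled (V ∪ {c | c ∈ gates.map Prod.fst}) (evolve (cnots gates) ρ) := by
  induction gates with
  | nil => simpa [cnots, evolve] using hρ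
  | cons g gates ih =>
    rw [List.map_cons, List.nodup_cons] at hnodup
    rw [List.forall_mem_cons] at hne hV
    rw [cnots_cons, evolve_mul]
    have tail := (ih hne.2 hV.2 hnodup.2).evolve_cnot hne.1 (not_or.mpr ⟨hV.1, hnodup.1⟩)
    refine tail.mono ?_
    rintro c (rfl | hc | hc) <;> simp_all

theorem blochX_evolve_cnots {gates : List (Fin n × Fin n)} (hne : ∀ g ∈ gates, g.1 ≠ g.2)
    (h0 : ∀ g ∈ gates, g.1 ≠ 0) (ρ : Operator n) :
    blochX (evolve (cnots gates) ρ) = blochX ρ := by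
  induction gates with
  | nil => simp [cnots, evolve]
  | cons g gates ih =>
    rw [List.forall_mem_cons] at hne h0
    rw [cnots_cons, evolve_mul, ← ih hne.2 h0.2, blochX, expectation_evolve,
      evolve_cnot_onQubit hne.1 h0.1 fun _ => by rw [sigma_one_mul_self, Matrix.one_mul]]

theorem IsTwirled.blochZ_evolve_cnot (hρ : IsTwirled V ρ) (h0V : 0 ∉ V) {c : Fin n} (hc : c ≠ 0)
    (hcV : c ∉ V) : blochZ (evolve (cnot c 0) ρ) = 0 := by
  rw [blochZ, expectation_evolve, onQubit, evolve_cnot_tensor_of_anticommute hc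
    (Function.update_of_ne hc ..)
    (by rw [Function.update_self, sigma_one_mul_sigma_three_mul_sigma_one])]
  refine hρ _ (fun r hr => ?_) c hc (by rw [Function.update_self]; exact antiY_sigma_three)
  rw [Function.update_of_ne (by rintro rfl; exact hcV hr),
    Function.update_of_ne (by rintro rfl; exact h0V hr)]

theorem IsTwirled.blochZ_evolve_cnots (hρ : IsTwirled V ρ) (h0V : 0 ∉ V)
    {gates : List (Fin n × Fin n)} (hne : ∀ g ∈ gates, g.1 ≠ g.2) (hV : ∀ g ∈ gates, g.1 ∉ V)
    (h0 : ∀ g ∈ gates, g.1 ≠ 0) (hnodup : (gates.map Prod.fst).Nodup)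
    (hgate : ∃ g ∈ gates, g.2 = 0) :
    blochZ (evolve (cnots gates) ρ) = 0 := by
  induction gates with
  | nil => simp at hgate
  | cons g gates ih =>
    rw [List.map_cons, List.nodup_cons] at hnodup
    rw [List.forall_mem_cons] at hne hV h0
    rw [cnots_cons, evolve_mul]
    by_cases hg : g.2 = 0
    · rw [hg]
      exact (hρ.evolve_cnots hne.2 hV.2 hnodup.2).blochZ_evolve_cnot
        (by simpa [h0V] using fun q hq => h0.2 (0, q) hq rfl) h0.1
        (not_or.mpr ⟨hV.1, hnodup.1⟩)
    · rw [blochZ, expectation_evolve, evolve_cnot_onQubit hne.1 h0.1 (absurd · hg)]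
      exact ih hne.2 hV.2 h0.2 hnodup.2 (by simpa [hg] using hgate)

end TwirledStates

section CnotLayers

variable {n j : ℕ}

/-- The control and the target of each gate of the CNOT layer number `j`. -/
def layerGates (n j : ℕ) : List (Fin n × Fin n) :=
  (List.finRange n).filterMap fun q =>
    if h : IsTarget n j q then some (⟨(q : ℕ) + 2 ^ j, h.2⟩, q) else none

theorem cnotLayer_eq_cnots (n j : ℕ) : cnotLayer n j = cnots (layerGates n j) := by
  rw [cnotLayer, List.ofFn_eq_map, layerGates]
  induction List.finRange n with
  | nil => rfl
  | cons q l ih =>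
    rw [List.map_cons, List.prod_cons, ih, List.filterMap_cons]
    split_ifs
    · rw [cnots_cons]
    · rw [one_mul]

theorem mem_layerGates {g : Fin n × Fin n} :
    g ∈ layerGates n j ↔ IsTarget n j g.2 ∧ (g.1 : ℕ) = g.2 + 2 ^ j := by
  obtain ⟨c, t⟩ := g
  simp only [layerGates, List.mem_filterMap, List.mem_finRange, true_and,
    Option.dite_none_right_eq_some, Option.some.injEq, Prod.mk.injEq, Fin.ext_iff]
  constructor
  · rintro ⟨q, hq, hc, hqt⟩
    obtain rfl := Fin.ext hqt
    exact ⟨hq, hc.symm⟩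
  · rintro ⟨ht, hc⟩
    exact ⟨t, ht, hc.symm, rfl⟩

theorem pow_dvd_control {c t : Fin n} (h : (c, t) ∈ layerGates n j) (i : ℕ) :
    2 ^ i ∣ (c : ℕ) ↔ i ≤ j := by
  obtain ⟨⟨ht, -⟩, hc⟩ := mem_layerGates.mp h
  rw [hc]
  constructor
  · intro hi
    by_contra! hij
    have dvd := (pow_dvd_pow 2 hij).trans hi
    rw [Nat.dvd_add_right ht, Nat.pow_dvd_pow_iff_le_right Nat.one_lt_two] at dvd
    omega
  · intro hij
    exact ((pow_dvd_pow 2 (hij.trans j.le_succ)).trans ht).add (pow_dvd_pow 2 hij)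

theorem control_ne_target {g : Fin n × Fin n} (hg : g ∈ layerGates n j) : g.1 ≠ g.2 := fun h => by
  have control_eq := (mem_layerGates.mp hg).2
  rw [h] at control_eq
  have := Nat.two_pow_pos j
  omega

theorem control_ne_zero [NeZero n] {g : Fin n × Fin n} (hg : g ∈ layerGates n j) : g.1 ≠ 0 := by
  intro h
  have := (pow_dvd_control hg (j + 1)).mp (by simp [h])
  omega

theorem nodup_controls (n j : ℕ) : ((layerGates n j).map Prod.fst).Nodup := by
  refine List.Nodup.map_on (fun g hg g' hg' h => Prod.ext h (Fin.ext ?_))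
    ((List.nodup_finRange n).filterMap ?_)
  · have := (mem_layerGates.mp hg).2
    have := (mem_layerGates.mp hg').2
    rw [h] at *
    omega
  · intro q r g hq hr
    simp only [Option.mem_def, Option.dite_none_right_eq_some, Option.some.injEq] at hq hr
    obtain ⟨_, rfl⟩ := hq
    obtain ⟨_, hr⟩ := hr
    exact (congrArg Prod.snd hr).symm

theorem exists_gate_target_zero [NeZero n] (hj : j < depth n) :
    ∃ g ∈ layerGates n j, g.2 = 0 := by
  have hn : 2 ^ j < n := (Nat.lt_clog_iff_pow_lt Nat.one_lt_two).mp hj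
  exact ⟨(⟨2 ^ j, hn⟩, 0), mem_layerGates.mpr (by simp [IsTarget, hn]), rfl⟩

theorem cnotLayer_mem_unitaryGroup (n j : ℕ) :
    cnotLayer n j ∈ Matrix.unitaryGroup (Fin n → Fin 2) ℂ := by
  rw [cnotLayer_eq_cnots]
  refine list_prod_mem fun U hU => ?_
  obtain ⟨g, hg, rfl⟩ := List.mem_map.mp hU
  exact cnot_mem_unitaryGroup (control_ne_target hg)

variable (n j) in
/-- The qubits that are the control of a gate in one of the CNOT layers `0, …, j - 1`: the controls
of layer `i` are the qubits whose number has `2`-adic valuation exactly `i`. -/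
def usedQubits : Set (Fin n) := {q | ¬ 2 ^ j ∣ (q : ℕ)}

theorem control_notMem_usedQubits {g : Fin n × Fin n} (hg : g ∈ layerGates n j) :
    g.1 ∉ usedQubits n j :=
  not_not_intro ((pow_dvd_control hg j).mpr le_rfl)

variable [NeZero n] {ρ : Operator n}

theorem IsTwirled.evolve_cnotLayer (hρ : IsTwirled (usedQubits n j) ρ) :
    IsTwirled (usedQubits n (j + 1)) (evolve (cnotLayer n j) ρ) := by
  rw [cnotLayer_eq_cnots]
  refine (hρ.evolve_cnots (fun _ => control_ne_target) (fun _ => control_notMem_usedQubits)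
    (nodup_controls n j)).mono (Set.union_subset ?_ ?_)
  · exact fun q hq hdvd => hq ((pow_dvd_pow 2 j.le_succ).trans hdvd)
  · intro c hc hdvd
    obtain ⟨g, hg, rfl⟩ := List.mem_map.mp hc
    have := (pow_dvd_control hg (j + 1)).mp hdvd
    omega

theorem blochX_evolve_cnotLayer (ρ : Operator n) (j : ℕ) :
    blochX (evolve (cnotLayer n j) ρ) = blochX ρ := by
  rw [cnotLayer_eq_cnots]
  exact blochX_evolve_cnots (fun _ => control_ne_target) (fun _ => control_ne_zero) ρ

theorem IsTwirled.blochZ_evolve_cnotLayer (hρ : IsTwirled (usedQubits n j) ρ) (hj : j < depth n) :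
    blochZ (evolve (cnotLayer n j) ρ) = 0 := by
  rw [cnotLayer_eq_cnots]
  exact hρ.blochZ_evolve_cnots (by simp [usedQubits]) (fun _ => control_ne_target)
    (fun _ => control_notMem_usedQubits) (fun _ => control_ne_zero) (nodup_controls n j)
    (exists_gate_target_zero hj)

end CnotLayers

section Circuit

variable {n : ℕ} {θ : EuclideanSpace ℝ (Param n)} {ℓ : Fin (depth n + 1)}

theorem rotationLayer_mem_unitaryGroup (θ : EuclideanSpace ℝ (Param n)) (ℓ : Fin (depth n + 1)) :
    rotationLayer θ ℓ ∈ Matrix.unitaryGroup (Fin n → Fin 2) ℂ :=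
  tensor_mem_unitaryGroup fun q => by
    split_ifs
    exacts [rotation_mem_unitaryGroup _, one_mem _]

theorem rotationLayer_add (θ η : EuclideanSpace ℝ (Param n)) (ℓ : Fin (depth n + 1)) :
    rotationLayer (θ + η) ℓ = rotationLayer θ ℓ * rotationLayer η ℓ := by
  rw [rotationLayer, rotationLayer, rotationLayer, tensor_mul]
  congr 1
  funext q
  split_ifs
  · rw [PiLp.add_apply, rotation_add]
  · rw [one_mul]

theorem partialCircuit_zero (θ : EuclideanSpace ℝ (Param n)) :
    partialCircuit θ 0 = rotationLayer θ 0 := rfl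

theorem partialCircuit_succ (θ : EuclideanSpace ℝ (Param n)) (j : Fin (depth n)) :
    partialCircuit θ j.succ =
      rotationLayer θ j.succ * cnotLayer n j * partialCircuit θ j.castSucc := rfl

theorem partialCircuit_mem_unitaryGroup (θ : EuclideanSpace ℝ (Param n)) (ℓ : Fin (depth n + 1)) :
    partialCircuit θ ℓ ∈ Matrix.unitaryGroup (Fin n → Fin 2) ℂ := by
  induction ℓ using Fin.induction with
  | zero => exact rotationLayer_mem_unitaryGroup θ 0
  | succ j ih =>
    exact mul_mem (mul_mem (rotationLayer_mem_unitaryGroup θ _) (cnotLayer_mem_unitaryGroup n j)) ih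

theorem rotationLayer_single_self (p : Param n) (t : ℝ) :
    rotationLayer (EuclideanSpace.single p t) p.1.1 = onQubit p.1.2 (rotation t) := by
  rw [rotationLayer, onQubit]
  congr 1
  funext q
  obtain rfl | hq := eq_or_ne q p.1.2
  · rw [dif_pos p.2, Function.update_self, PiLp.single_eq_same]
  · rw [Function.update_of_ne hq]
    split_ifs with h
    · have hne : (⟨(p.1.1, q), h⟩ : Param n) ≠ p := fun h' => hq (congrArg (·.1.2) h')
      rw [PiLp.single_eq_of_ne 2 hne, rotation_zero]
    · rfl

theorem rotationLayer_single_of_ne {p : Param n} (h : p.1.1 ≠ ℓ) (t : ℝ) :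
    rotationLayer (EuclideanSpace.single p t) ℓ = 1 := by
  rw [rotationLayer, ← tensor_one]
  congr 1
  funext q
  split_ifs with hq
  · have hne : (⟨(ℓ, q), hq⟩ : Param n) ≠ p := fun h' => h (congrArg (·.1.1) h').symm
    rw [PiLp.single_eq_of_ne 2 hne, rotation_zero]
  · rfl

theorem partialCircuit_add_single_of_lt {p : Param n} (h : ℓ < p.1.1) (t : ℝ) :
    partialCircuit (θ + EuclideanSpace.single p t) ℓ = partialCircuit θ ℓ := by
  induction ℓ using Fin.induction with
  | zero => rw [partialCircuit_zero, partialCircuit_zero, rotationLayer_add,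
      rotationLayer_single_of_ne h.ne', mul_one]
  | succ j ih => rw [partialCircuit_succ, partialCircuit_succ, rotationLayer_add,
      rotationLayer_single_of_ne h.ne', mul_one, ih (j.castSucc_lt_succ.trans h)]

theorem partialCircuit_add_single_self (θ : EuclideanSpace ℝ (Param n)) (p : Param n) (t : ℝ) :
    partialCircuit (θ + EuclideanSpace.single p t) p.1.1 =
      onQubit p.1.2 (rotation t) * partialCircuit θ p.1.1 := by
  rw [← rotationLayer_single_self]
  obtain hp | ⟨j, hp⟩ := p.1.1.eq_zero_or_eq_succ
  · rw [hp, partialCircuit_zero, partialCircuit_zero, add_comm, rotationLayer_add]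
  · rw [hp, partialCircuit_succ, partialCircuit_succ,
      partialCircuit_add_single_of_lt (hp ▸ j.castSucc_lt_succ), add_comm, rotationLayer_add,
      mul_assoc, mul_assoc, mul_assoc]

theorem exists_partialCircuit_add_single_eq {p : Param n} (h : p.1.1 ≤ ℓ) :
    ∃ L : Operator n, ∀ t, partialCircuit (θ + EuclideanSpace.single p t) ℓ =
      L * (onQubit p.1.2 (rotation t) * partialCircuit θ p.1.1) := by
  induction ℓ using Fin.induction with
  | zero =>
    refine ⟨1, fun t => ?_⟩
    rw [← Fin.le_zero_iff.mp h, partialCircuit_add_single_self, one_mul]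
  | succ j ih =>
    obtain hp | hp := h.eq_or_lt
    · refine ⟨1, fun t => ?_⟩
      rw [← hp, partialCircuit_add_single_self, one_mul]
    obtain ⟨L, hL⟩ := ih (Fin.le_castSucc_iff.mpr hp)
    refine ⟨rotationLayer θ j.succ * cnotLayer n j * L, fun t => ?_⟩
    rw [partialCircuit_succ, hL, rotationLayer_add, rotationLayer_single_of_ne hp.ne, mul_one,
      mul_assoc _ L]

variable [NeZero n]

theorem isSinusoidal_objective (ρ : Operator n) : IsSinusoidal (objective ρ) := fun p θ => by
  obtain ⟨L, hL⟩ := exists_partialCircuit_add_single_eq (θ := θ) (Fin.le_last p.1.1)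
  set R := partialCircuit θ p.1.1
  obtain ⟨a, b, c, h⟩ := exists_expectation_evolve_eq_sinusoid (onQubit 0 (sigma 3)) ρ
    (L * R) (L * (onQubit p.1.2 quarterTurn * R))
  have circuit_eq (t : ℝ) : circuit (θ + EuclideanSpace.single p t) =
      Real.cos t • (L * R) + Real.sin t • (L * (onQubit p.1.2 quarterTurn * R)) := by
    rw [circuit, hL, rotation_eq_cos_add_sin, onQubit_smul_add_smul, onQubit_one]
    simp only [mul_add, add_mul, mul_smul_comm, smul_mul_assoc, one_mul]
  refine ⟨1 / 2 + a / 2, b / 2, c / 2, fun t => ?_⟩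
  rw [objective_eq_blochZ, circuit_eq, blochZ, h]
  ring

end Circuit

section Differentiability

attribute [local instance] Matrix.frobeniusNormedRing Matrix.frobeniusNormedAlgebra

variable {n : ℕ}

theorem differentiable_expectation_evolve {m : Type*} [Fintype m]
    (A ρ : Matrix m m ℂ) :
    Differentiable ℝ fun U => expectation A (evolve U ρ) := by
  classical
  have linear : Differentiable ℝ (expectation A) :=
    (LinearMap.toContinuousLinearMap (expectation A)).differentiable
  exact linear.comp ((differentiable_id.mul_const ρ).mul differentiable_id.star)

theorem differentiable_tensor : Differentiable ℝ (tensor (n := n)) := by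
  have entry (q : Fin n) (a b : Fin 2) :
      Differentiable ℝ fun A : Fin n → Matrix (Fin 2) (Fin 2) ℂ => A q a b := by
    fun_prop
  refine differentiable_pi.mpr fun x => differentiable_pi.mpr fun y => fun A => ?_
  exact (HasFDerivAt.finsetProd (u := Finset.univ) fun q _ =>
    (entry q (x q) (y q) A).hasFDerivAt).differentiableAt

theorem differentiable_rotation : Differentiable ℝ rotation := by
  simp only [funext rotation_eq_cos_add_sin]
  fun_prop

theorem differentiable_rotationLayer (ℓ : Fin (depth n + 1)) :
    Differentiable ℝ fun θ : EuclideanSpace ℝ (Param n) => rotationLayer θ ℓ := by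
  refine differentiable_tensor.comp (differentiable_pi.mpr fun q => ?_)
  split_ifs with h
  · exact differentiable_rotation.comp (by fun_prop)
  · exact differentiable_const 1

theorem differentiable_partialCircuit (ℓ : Fin (depth n + 1)) :
    Differentiable ℝ fun θ : EuclideanSpace ℝ (Param n) => partialCircuit θ ℓ := by
  induction ℓ using Fin.induction with
  | zero => exact differentiable_rotationLayer 0
  | succ j ih => exact ((differentiable_rotationLayer j.succ).mul_const _).mul ih

theorem differentiable_objective [NeZero n] (ρ : Operator n) : Differentiable ℝ (objective ρ) := by
  simp only [funext (objective_eq_blochZ ρ)]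
  exact (((differentiable_expectation_evolve _ ρ).comp
    (differentiable_partialCircuit (Fin.last _))).const_mul _).const_add _

end Differentiability

section CircuitHead

variable {n : ℕ}

theorem rotationLayer_eq_tensor_rotation (θ : EuclideanSpace ℝ (Param n)) (ℓ : Fin (depth n + 1)) :
    rotationLayer θ ℓ =
      tensor fun q => rotation (if h : HasRotation n ℓ q then θ ⟨(ℓ, q), h⟩ else 0) := by
  rw [rotationLayer]
  congr 1
  funext q
  split_ifs
  · rfl
  · rw [rotation_zero]

variable [NeZero n]

theorem hasRotation_zero (ℓ : Fin (depth n + 1)) : HasRotation n ℓ 0 := by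
  cases ℓ using Fin.cases with
  | zero => trivial
  | succ j =>
    have hn : 2 ^ (j : ℕ) < n := (Nat.lt_clog_iff_pow_lt Nat.one_lt_two).mp j.isLt
    exact ⟨dvd_zero _, by simpa using hn⟩

variable (n) in
/-- The parameter of the rotation of the first qubit in the rotation layer number `ℓ`. -/
def headParam (ℓ : Fin (depth n + 1)) : Param n := ⟨(ℓ, 0), hasRotation_zero ℓ⟩

theorem headParam_injective : Function.Injective (headParam n) := fun _ _ h =>
  congrArg (·.1.1) h

variable {ρ : Operator n} {V : Set (Fin n)}

theorem IsTwirled.evolve_rotationLayer (hρ : IsTwirled V ρ) (θ : EuclideanSpace ℝ (Param n))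
    (ℓ : Fin (depth n + 1)) : IsTwirled V (evolve (rotationLayer θ ℓ) ρ) := by
  rw [rotationLayer_eq_tensor_rotation]
  exact hρ.evolve_rotation _

theorem blochX_evolve_rotationLayer (θ : EuclideanSpace ℝ (Param n)) (ℓ : Fin (depth n + 1))
    (ρ : Operator n) :
    blochX (evolve (rotationLayer θ ℓ) ρ) =
      Real.cos (2 * θ (headParam n ℓ)) * blochX ρ +
        Real.sin (2 * θ (headParam n ℓ)) * blochZ ρ := by
  rw [rotationLayer_eq_tensor_rotation, blochX_evolve_rotation, dif_pos (hasRotation_zero ℓ),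
    headParam]

theorem IsTwirled.evolve_partialCircuit (hρ : IsTwirled ∅ ρ) (θ : EuclideanSpace ℝ (Param n))
    (ℓ : Fin (depth n + 1)) : IsTwirled (usedQubits n ℓ) (evolve (partialCircuit θ ℓ) ρ) := by
  induction ℓ using Fin.induction with
  | zero => exact (hρ.evolve_rotationLayer θ 0).mono (Set.empty_subset _)
  | succ j ih =>
    rw [partialCircuit_succ, evolve_mul, evolve_mul]
    exact ih.evolve_cnotLayer.evolve_rotationLayer θ j.succ

/-- The factor contributed by the rotation of the first qubit in layer `ℓ`, at angle `t`, to
`blochX` of the output of the circuit on a twirled state with Bloch coordinates `x` and `z`. -/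
def headFactor (x z : ℝ) (ℓ : Fin (depth n + 1)) (t : ℝ) : ℝ :=
  if ℓ = 0 then Real.cos (2 * t) * x + Real.sin (2 * t) * z else Real.cos (2 * t)

theorem IsTwirled.blochX_evolve_partialCircuit (hρ : IsTwirled ∅ ρ)
    (θ : EuclideanSpace ℝ (Param n)) (ℓ : Fin (depth n + 1)) :
    blochX (evolve (partialCircuit θ ℓ) ρ) =
      ∏ k ∈ Finset.Iic ℓ, headFactor (blochX ρ) (blochZ ρ) k (θ (headParam n k)) := by
  induction ℓ using Fin.induction with
  | zero =>
    have Iic_zero : Finset.Iic (0 : Fin (depth n + 1)) = {0} := Finset.Iic_bot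
    rw [partialCircuit_zero, blochX_evolve_rotationLayer, Iic_zero, Finset.prod_singleton,
      headFactor, if_pos rfl]
  | succ j ih =>
    have Iic_succ : Finset.Iic j.succ = insert j.succ (Finset.Iic j.castSucc) := by
      ext k
      simp only [Finset.mem_Iic, Finset.mem_insert, Fin.le_def, Fin.ext_iff, Fin.val_succ,
        Fin.val_castSucc]
      omega
    have blochZ_eq_zero : blochZ (evolve (cnotLayer n j) (evolve (partialCircuit θ j.castSucc) ρ)) =
        0 := (hρ.evolve_partialCircuit θ j.castSucc).blochZ_evolve_cnotLayer j.isLt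
    rw [partialCircuit_succ, evolve_mul, evolve_mul, blochX_evolve_rotationLayer,
      blochZ_eq_zero, mul_zero, add_zero, blochX_evolve_cnotLayer, ih, Iic_succ,
      Finset.prod_insert (by simp), headFactor, if_neg j.succ_ne_zero]

theorem IsTwirled.blochX_evolve_circuit (hρ : IsTwirled ∅ ρ) (θ : EuclideanSpace ℝ (Param n)) :
    blochX (evolve (circuit θ) ρ) =
      ∏ k, headFactor (blochX ρ) (blochZ ρ) k (θ (headParam n k)) := by
  rw [circuit, hρ.blochX_evolve_partialCircuit, ← Fin.top_eq_last, Finset.Iic_top]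

end CircuitHead

section Twirl

variable {n : ℕ}

/-- The shift of the parameters that adds the angle `a q` to the first rotation of qubit `q`. -/
def firstLayerShift (a : Fin n → ℝ) : EuclideanSpace ℝ (Param n) :=
  WithLp.toLp 2 fun p => if p.1.1 = 0 then a p.1.2 else 0

theorem partialCircuit_add_firstLayerShift (θ : EuclideanSpace ℝ (Param n)) (a : Fin n → ℝ)
    (ℓ : Fin (depth n + 1)) :
    partialCircuit (θ + firstLayerShift a) ℓ =
      partialCircuit θ ℓ * tensor fun q => rotation (a q) := by
  induction ℓ using Fin.induction with
  | zero =>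
    have first_layer : rotationLayer (firstLayerShift a) 0 = tensor fun q => rotation (a q) :=
      congrArg tensor <| funext fun q => by simp [firstLayerShift, HasRotation]
    rw [partialCircuit_zero, partialCircuit_zero, rotationLayer_add, first_layer]
  | succ j ih =>
    have later_layer : rotationLayer (firstLayerShift a) j.succ = 1 := by
      rw [rotationLayer, ← tensor_one]
      exact congrArg tensor <| funext fun q => by simp [firstLayerShift, rotation_zero]
    rw [partialCircuit_succ, partialCircuit_succ, rotationLayer_add, later_layer, ih, mul_one,
      mul_assoc, mul_assoc, mul_assoc]

variable [NeZero n]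

/-- The angle by which the twirl turns qubit `q` when its bit is `b`: the first qubit stays, and
each other one turns by `0` or `π / 2`. -/
def twirlAngle (q : Fin n) (b : Fin 2) : ℝ := if q = 0 then 0 else (b : ℕ) * (π / 2)

/-- The average of a state over half-period rotations of all qubits but the first, which erases
every correlation that anticommutes with `σ₂` on one of these qubits. -/
def twirl (ρ : Operator n) : Operator n :=
  (Fintype.card (Fin n → Fin 2) : ℝ)⁻¹ •
    ∑ s : Fin n → Fin 2, evolve (tensor fun q => rotation (twirlAngle q (s q))) ρ

theorem expectation_twirl (A ρ : Operator n) :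
    expectation A (twirl ρ) =
      (∑ s : Fin n → Fin 2,
        expectation A (evolve (tensor fun q => rotation (twirlAngle q (s q))) ρ)) /
          Fintype.card (Fin n → Fin 2) := by
  rw [twirl, map_smul, map_sum, smul_eq_mul, inv_mul_eq_div]

theorem isTwirled_twirl (ρ : Operator n) : IsTwirled ∅ (twirl ρ) := fun A _ q hq hAq => by
  let turned (r : Fin n) (b : Fin 2) := evolve (rotation (twirlAngle r b))ᴴ (A r)
  have turned_sum_eq_zero : ∑ b, turned q b = 0 := by
    simp only [turned, Fin.sum_univ_two, hAq.evolve_rotation, twirlAngle, if_neg hq, Fin.val_zero,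
      Fin.val_one, Nat.cast_zero, Nat.cast_one, zero_mul, one_mul, mul_zero, rotation_zero,
      mul_div_cancel₀ π two_ne_zero, rotation_pi, mul_one, mul_neg, add_neg_cancel]
  have sum_eq_zero : ∑ s : Fin n → Fin 2, tensor (fun r => turned r (s r)) = 0 := by
    simp only [← tensorMultilinear_apply]
    rw [← MultilinearMap.map_sum]
    exact (tensorMultilinear n).map_coord_zero q turned_sum_eq_zero
  simp only [expectation_twirl, expectation_evolve, evolve_tensor]
  rw [← LinearMap.sum_apply, ← map_sum, sum_eq_zero, map_zero, LinearMap.zero_apply, zero_div]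

theorem expectation_onQubit_zero_twirl (A : Matrix (Fin 2) (Fin 2) ℂ) (ρ : Operator n) :
    expectation (onQubit 0 A) (twirl ρ) = expectation (onQubit 0 A) ρ := by
  have fixed (s : Fin n → Fin 2) :
      expectation (onQubit 0 A) (evolve (tensor fun q => rotation (twirlAngle q (s q))) ρ) =
        expectation (onQubit 0 A) ρ := by
    rw [expectation_evolve, evolve_tensor_onQubit fun q => rotation_mem_unitaryGroup _, twirlAngle,
      if_pos rfl, rotation_zero, evolve, conjTranspose_conjTranspose, conjTranspose_one, mul_one,
      one_mul]
  rw [expectation_twirl, Finset.sum_congr rfl fun s _ => fixed s, Finset.sum_const,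
    Finset.card_univ, nsmul_eq_mul,
    mul_div_cancel_left₀ _ (Nat.cast_ne_zero.mpr Fintype.card_ne_zero)]

theorem alpha_twirl (ρ : Operator n) : alpha (twirl ρ) = alpha ρ := by
  simp only [alpha_eq_blochX_sq_add_blochZ_sq, blochX, blochZ, expectation_onQubit_zero_twirl]

theorem objective_twirl (ρ : Operator n) (θ : EuclideanSpace ℝ (Param n)) :
    objective (twirl ρ) θ =
      (∑ s : Fin n → Fin 2, objective ρ (θ + firstLayerShift fun q => twirlAngle q (s q))) /
        Fintype.card (Fin n → Fin 2) := by
  have card_ne_zero : (Fintype.card (Fin n → Fin 2) : ℝ) ≠ 0 :=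
    Nat.cast_ne_zero.mpr Fintype.card_ne_zero
  simp only [objective_eq_blochZ, circuit, partialCircuit_add_firstLayerShift, evolve_mul, blochZ,
    expectation_evolve _ (partialCircuit θ _), expectation_twirl]
  rw [Finset.sum_add_distrib, ← Finset.mul_sum, Finset.sum_const, Finset.card_univ, nsmul_eq_mul]
  field_simp

theorem parameterShift_objective_twirl (ρ : Operator n) (p : Param n)
    (θ : EuclideanSpace ℝ (Param n)) :
    parameterShift (objective (twirl ρ)) p θ =
      (∑ s : Fin n → Fin 2,
        parameterShift (objective ρ) p (θ + firstLayerShift fun q => twirlAngle q (s q))) /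
          Fintype.card (Fin n → Fin 2) := by
  simp only [parameterShift, objective_twirl, add_right_comm θ, Finset.sum_sub_distrib, sub_div]

end Twirl

section Variance

variable {n : ℕ}

theorem antiperiodic_headFactor (x z : ℝ) (ℓ : Fin (depth n + 1)) :
    Function.Antiperiodic (headFactor x z ℓ) (π / 2) := fun t => by
  have angle : 2 * (t + π / 2) = 2 * t + π := by ring
  simp only [headFactor, angle, Real.cos_add_pi, Real.sin_add_pi]
  split_ifs <;> ring

theorem periodic_headFactor (x z : ℝ) (ℓ : Fin (depth n + 1)) :
    Function.Periodic (headFactor x z ℓ) (2 * π) := by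
  have half_period := (antiperiodic_headFactor x z ℓ).periodic
  rw [two_nsmul, add_halves] at half_period
  exact_mod_cast half_period.nat_mul 2

theorem continuous_headFactor (x z : ℝ) (ℓ : Fin (depth n + 1)) :
    Continuous (headFactor x z ℓ) := by
  unfold headFactor
  split_ifs <;> fun_prop

theorem integral_headFactor_sq (x z : ℝ) (ℓ : Fin (depth n + 1)) :
    ∫ t, headFactor x z ℓ t ^ 2 ∂uniformAngle = if ℓ = 0 then (x ^ 2 + z ^ 2) / 2 else 1 / 2 := by
  simp only [headFactor]
  split_ifs
  · exact integral_uniformAngle_sinusoid_sq x z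
  · simpa using integral_uniformAngle_sinusoid_sq 1 0

variable [NeZero n] {ρ : Operator n}

theorem blochX_evolve_circuit_add_single (θ : EuclideanSpace ℝ (Param n)) (ρ : Operator n) :
    blochX (evolve (circuit (θ + EuclideanSpace.single (headParam n (Fin.last _)) (π / 4))) ρ) =
      blochZ (evolve (circuit θ) ρ) := by
  let p := headParam n (Fin.last (depth n))
  have angle : 2 * (π / 4) = π / 2 := by ring
  have circuit_eq : circuit (θ + EuclideanSpace.single p (π / 4)) =
      rotationLayer (EuclideanSpace.single p (π / 4)) p.1.1 * circuit θ := by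
    rw [rotationLayer_single_self]
    exact partialCircuit_add_single_self θ p _
  have head : headParam n p.1.1 = p := rfl
  rw [circuit_eq, evolve_mul, blochX_evolve_rotationLayer, head, PiLp.single_eq_same, angle,
    Real.cos_pi_div_two, Real.sin_pi_div_two, zero_mul, zero_add, one_mul]

theorem integral_prod_headFactor_sq (x z : ℝ) :
    ∫ θ, (∏ k, headFactor x z k (θ (headParam n k))) ^ 2 ∂uniformAngles (Param n) =
      (1 / 2) ^ (depth n + 1) * (x ^ 2 + z ^ 2) := by
  simp only [← Finset.prod_pow]
  rw [integral_uniformAngles_prod headParam_injective (g := fun k t => headFactor x z k t ^ 2)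
    fun k => (continuous_headFactor x z k).pow 2]
  simp only [integral_headFactor_sq, Fin.prod_univ_succ, if_true, Fin.succ_ne_zero, if_false,
    Finset.prod_const, Finset.card_univ, Fintype.card_fin]
  ring

theorem IsTwirled.objective_eq (hρ : IsTwirled ∅ ρ) (θ : EuclideanSpace ℝ (Param n)) :
    objective ρ θ = 1 / 2 + 1 / 2 * ∏ k, headFactor (blochX ρ) (blochZ ρ) k
      ((θ + EuclideanSpace.single (headParam n (Fin.last _)) (π / 4)) (headParam n k)) := by
  rw [objective_eq_blochZ, ← blochX_evolve_circuit_add_single, hρ.blochX_evolve_circuit]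

theorem IsTwirled.parameterShift_objective (hρ : IsTwirled ∅ ρ) (k : Fin (depth n + 1))
    (θ : EuclideanSpace ℝ (Param n)) :
    parameterShift (objective ρ) (headParam n k) θ =
      ∏ l, headFactor (blochX ρ) (blochZ ρ) l
        ((θ + (EuclideanSpace.single (headParam n k) (π / 4) +
          EuclideanSpace.single (headParam n (Fin.last _)) (π / 4))) (headParam n l)) := by
  have shift := parameterShift_of_antiperiodic (antiperiodic_prod_apply headParam_injective
    (antiperiodic_headFactor (blochX ρ) (blochZ ρ) k))
    (θ + EuclideanSpace.single (headParam n (Fin.last _)) (π / 4))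
  simp only [parameterShift, hρ.objective_eq, ← add_assoc] at shift ⊢
  simp only [add_right_comm θ (EuclideanSpace.single (headParam n (Fin.last _)) _)] at shift
  linarith

theorem IsTwirled.integral_parameterShift_objective_sq (hρ : IsTwirled ∅ ρ)
    (k : Fin (depth n + 1)) :
    ∫ θ, parameterShift (objective ρ) (headParam n k) θ ^ 2 ∂uniformAngles (Param n) =
      (1 / 2) ^ (depth n + 1) * alpha ρ := by
  let N (θ : EuclideanSpace ℝ (Param n)) : ℝ :=
    ∏ l, headFactor (blochX ρ) (blochZ ρ) l (θ (headParam n l))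
  have continuous_N : Continuous N := continuous_finsetProd _ fun l _ =>
    (continuous_headFactor _ _ l).comp (by fun_prop)
  have periodic_N (p : Param n) : Function.Periodic N (EuclideanSpace.single p (2 * π)) :=
    periodic_prod_apply (fun l => periodic_headFactor _ _ l) p
  simp only [hρ.parameterShift_objective]
  rw [integral_uniformAngles_add (f := fun θ => N θ ^ 2) (continuous_N.pow 2) fun p θ =>
    congrArg (· ^ 2) (periodic_N p θ), integral_prod_headFactor_sq,
    alpha_eq_blochX_sq_add_blochZ_sq]

theorem le_integral_parameterShift_objective_sq (ρ : Operator n) (k : Fin (depth n + 1)) :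
    (1 / 2) ^ (depth n + 1) * alpha ρ ≤
      ∫ θ, parameterShift (objective ρ) (headParam n k) θ ^ 2 ∂uniformAngles (Param n) := by
  rw [← alpha_twirl, ← (isTwirled_twirl ρ).integral_parameterShift_objective_sq k]
  simp only [parameterShift_objective_twirl]
  exact integral_sq_average_translates_le
    (continuous_parameterShift (differentiable_objective ρ).continuous _)
    (fun i => periodic_parameterShift ((isSinusoidal_objective ρ).periodic i) _) _

end Variance

section Range

open scoped ComplexOrder in
theorem expectation_le_trace {m : Type*} [Fintype m] [DecidableEq m] {A ρ : Matrix m m ℂ}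
    (hρ : ρ.PosSemidef) (hA : A.IsHermitian) (hAA : A * A = 1) :
    expectation A ρ ≤ ρ.trace.re := by
  have square : (1 - A)ᴴ * (1 - A) = (2 : ℝ) • (1 - A) := by
    rw [conjTranspose_sub, conjTranspose_one, hA.eq, two_smul, mul_sub, sub_mul, sub_mul, hAA]
    noncomm_ring
  have nonneg := expectation_conjTranspose_mul_self_nonneg hρ (1 - A)
  rw [square, map_smul, map_sub, LinearMap.smul_apply, LinearMap.sub_apply, expectation_apply 1,
    Matrix.one_mul, smul_eq_mul] at nonneg
  linarith

variable {n : ℕ} {ρ : Operator n}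

open scoped ComplexOrder in
theorem IsState.evolve (hρ : IsState ρ) {U : Operator n}
    (hU : U ∈ Matrix.unitaryGroup (Fin n → Fin 2) ℂ) : IsState (evolve U ρ) where
  posSemidef := hρ.posSemidef.mul_mul_conjTranspose_same U
  trace_eq_one := by
    rw [DTTQNN.evolve, Matrix.trace_mul_cycle, ← star_eq_conjTranspose,
      Matrix.mem_unitaryGroup_iff'.mp hU, Matrix.one_mul, hρ.trace_eq_one]

variable [NeZero n]

theorem IsState.abs_blochZ_le_one (hρ : IsState ρ) : |blochZ ρ| ≤ 1 := by
  let Z : Operator n := onQubit 0 (sigma 3)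
  have isHermitian_Z : Z.IsHermitian :=
    (map_star (onQubitHom 0) (sigma 3)).symm.trans (congrArg (onQubit 0) (isHermitian_sigma 3))
  have Z_mul_self : Z * Z = 1 := by
    rw [← onQubit_one 0, ← show sigma 3 * sigma 3 = 1 by simp [sigma, Matrix.one_fin_two]]
    exact (map_mul (onQubitHom 0) _ _).symm
  have trace_eq_one : ρ.trace.re = 1 := by rw [hρ.trace_eq_one, Complex.one_re]
  have upper := expectation_le_trace hρ.posSemidef isHermitian_Z Z_mul_self
  have lower := expectation_le_trace hρ.posSemidef isHermitian_Z.neg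
    (by rw [neg_mul_neg, Z_mul_self])
  rw [map_neg, LinearMap.neg_apply] at lower
  exact abs_le'.mpr ⟨upper.trans_eq trace_eq_one, lower.trans_eq trace_eq_one⟩

theorem IsState.parameterShift_objective_sq_le_one (hρ : IsState ρ) (p : Param n)
    (θ : EuclideanSpace ℝ (Param n)) : parameterShift (objective ρ) p θ ^ 2 ≤ 1 := by
  have bounds (η : EuclideanSpace ℝ (Param n)) :=
    abs_le.mp (hρ.evolve (partialCircuit_mem_unitaryGroup η (Fin.last _))).abs_blochZ_le_one
  have plus := bounds (θ + EuclideanSpace.single p (π / 4))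
  have minus := bounds (θ + EuclideanSpace.single p (-(π / 4)))
  rw [sq_le_one_iff_abs_le_one, parameterShift, objective_eq_blochZ, objective_eq_blochZ, abs_le]
  unfold circuit
  constructor <;> linarith

end Range

section Counting

variable {n : ℕ}

/-- Numbers the rotations: those of the first layer by their qubit, each later one by the control
of the CNOT gate that precedes it. -/
def rotationIndex : Param n → Fin n ⊕ Fin n
  | ⟨(⟨0, _⟩, q), _⟩ => Sum.inl q
  | ⟨(⟨j + 1, _⟩, q), h⟩ => Sum.inr ⟨q + 2 ^ j, h.2⟩

theorem mem_layerGates_of_isTarget {j : ℕ} {q : Fin n} (h : IsTarget n j q) :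
    (⟨q + 2 ^ j, h.2⟩, q) ∈ layerGates n j :=
  mem_layerGates.mpr ⟨h, rfl⟩

theorem rotationIndex_injective : Function.Injective (rotationIndex (n := n)) := by
  rintro ⟨⟨⟨_ | i, _⟩, q⟩, hq⟩ ⟨⟨⟨_ | j, _⟩, r⟩, hr⟩ h
  · obtain rfl := Sum.inl_injective h
    rfl
  · cases h
  · cases h
  · have control_eq := Sum.inr_injective h
    have gate_q := mem_layerGates_of_isTarget hq
    have gate_r := mem_layerGates_of_isTarget hr
    have layer_eq : i = j := le_antisymm
      ((pow_dvd_control gate_r i).mp (control_eq ▸ (pow_dvd_control gate_q i).mpr le_rfl))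
      ((pow_dvd_control gate_q j).mp (control_eq ▸ (pow_dvd_control gate_r j).mpr le_rfl))
    subst layer_eq
    obtain rfl : q = r := Fin.ext (Nat.add_right_cancel (congrArg Fin.val control_eq))
    rfl

theorem card_param_lt [NeZero n] : Fintype.card (Param n) < 2 * n := by
  have not_surjective : ¬ Function.Surjective (rotationIndex (n := n)) := fun h => by
    obtain ⟨⟨⟨⟨_ | j, _⟩, q⟩, hq⟩, h0⟩ := h (Sum.inr 0)
    · cases h0
    · exact control_ne_zero (mem_layerGates_of_isTarget hq) (Sum.inr_injective h0)
  simpa [two_mul] using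
    Fintype.card_lt_of_injective_not_surjective _ rotationIndex_injective not_surjective

theorem one_add_logb_div_le (hn : n ≠ 0) :
    (1 + Real.logb 2 n) / (4 * n) ≤ (depth n + 1) * (1 / 2) ^ (depth n + 1) := by
  have n_pos : (0 : ℝ) < n := Nat.cast_pos.mpr (Nat.pos_of_ne_zero hn)
  have logb_le : Real.logb 2 n ≤ depth n := by
    rw [Real.logb_le_iff_le_rpow one_lt_two n_pos, Real.rpow_natCast]
    exact_mod_cast Nat.le_pow_clog one_lt_two n
  have pow_le : 2 ^ (depth n + 1) ≤ 4 * n := by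
    cases hd : depth n with
    | zero => omega
    | succ d =>
      have := (Nat.lt_clog_iff_pow_lt one_lt_two).mp (d.lt_succ_self.trans_eq hd.symm)
      rw [pow_succ, pow_succ]
      omega
  rw [one_div, inv_pow, ← div_eq_mul_inv]
  exact div_le_div₀ (by positivity) (by linarith) (by positivity) (mod_cast pow_le)

end Counting

section GradientNorm

variable {n : ℕ} [NeZero n]

theorem norm_gradient_objective_sq (ρ : Operator n) (θ : EuclideanSpace ℝ (Param n)) :
    ‖gradient (objective ρ) θ‖ ^ 2 = ∑ p, parameterShift (objective ρ) p θ ^ 2 :=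
  norm_gradient_sq_eq_sum_parameterShift_sq (isSinusoidal_objective ρ)
    (differentiable_objective ρ) θ

theorem integrable_parameterShift_objective_sq (ρ : Operator n) (p : Param n) :
    Integrable (fun θ => parameterShift (objective ρ) p θ ^ 2) (paramLaw n) :=
  integrable_uniformAngles_of_continuous
    ((continuous_parameterShift (differentiable_objective ρ).continuous p).pow 2)

theorem integrable_norm_gradient_objective_sq (ρ : Operator n) :
    Integrable (fun θ => ‖gradient (objective ρ) θ‖ ^ 2) (paramLaw n) := by
  simp only [norm_gradient_objective_sq]
  exact integrable_finsetSum _ fun p _ => integrable_parameterShift_objective_sq ρ p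

theorem integral_norm_gradient_objective_sq (ρ : Operator n) :
    ∫ θ, ‖gradient (objective ρ) θ‖ ^ 2 ∂paramLaw n =
      ∑ p, ∫ θ, parameterShift (objective ρ) p θ ^ 2 ∂paramLaw n := by
  simp only [norm_gradient_objective_sq]
  exact integral_finsetSum _ fun p _ => integrable_parameterShift_objective_sq ρ p

theorem le_integral_norm_gradient_objective_sq (ρ : Operator n) :
    (depth n + 1) * (1 / 2) ^ (depth n + 1) * alpha ρ ≤
      ∫ θ, ‖gradient (objective ρ) θ‖ ^ 2 ∂paramLaw n := by
  rw [integral_norm_gradient_objective_sq]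
  calc (depth n + 1) * (1 / 2) ^ (depth n + 1) * alpha ρ
      = ∑ _ : Fin (depth n + 1), (1 / 2) ^ (depth n + 1) * alpha ρ := by
        simp [mul_assoc]
    _ ≤ ∑ k, ∫ θ, parameterShift (objective ρ) (headParam n k) θ ^ 2 ∂paramLaw n :=
        Finset.sum_le_sum fun k _ => le_integral_parameterShift_objective_sq ρ k
    _ = ∑ p ∈ Finset.univ.map ⟨headParam n, headParam_injective⟩,
          ∫ θ, parameterShift (objective ρ) p θ ^ 2 ∂paramLaw n  := by
        rw [Finset.sum_map]; rfl
    _ ≤ ∑ p, ∫ θ, parameterShift (objective ρ) p θ ^ 2 ∂paramLaw n :=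
        Finset.sum_le_univ_sum_of_nonneg fun p => integral_nonneg fun θ => sq_nonneg _

theorem IsState.integral_norm_gradient_objective_sq_le {ρ : Operator n} (hρ : IsState ρ) :
    ∫ θ, ‖gradient (objective ρ) θ‖ ^ 2 ∂paramLaw n ≤ Fintype.card (Param n) := by
  have : IsProbabilityMeasure (paramLaw n) :=
    inferInstanceAs (IsProbabilityMeasure (uniformAngles (Param n)))
  rw [integral_norm_gradient_objective_sq, ← Finset.card_univ, Finset.cast_card]
  refine Finset.sum_le_sum fun p _ => ?_
  simpa using integral_mono (integrable_parameterShift_objective_sq ρ p) (integrable_const 1)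
    (hρ.parameterShift_objective_sq_le_one p)

end GradientNorm

end DTTQNN

end

theorem mainTheorem3 (n : ℕ) [NeZero n] (ρ : DTTQNN.Operator n) (hρ : DTTQNN.IsState ρ) :
    Differentiable ℝ (DTTQNN.objective ρ) ∧
    MeasureTheory.Integrable (fun θ => ‖gradient (DTTQNN.objective ρ) θ‖ ^ 2)
      (DTTQNN.paramLaw n) ∧
    (1 + Real.logb 2 n) / (4 * n) * DTTQNN.alpha ρ ≤
      ∫ θ, ‖gradient (DTTQNN.objective ρ) θ‖ ^ 2 ∂(DTTQNN.paramLaw n) ∧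
    ∫ θ, ‖gradient (DTTQNN.objective ρ) θ‖ ^ 2 ∂(DTTQNN.paramLaw n) ≤ 2 * (n : ℝ) - 1 := by
  have alpha_nonneg : 0 ≤ DTTQNN.alpha ρ := add_nonneg (sq_nonneg _) (sq_nonneg _)
  have card_add_one_le : (Fintype.card (DTTQNN.Param n) + 1 : ℝ) ≤ 2 * n := by
    exact_mod_cast DTTQNN.card_param_lt (n := n)
  refine ⟨DTTQNN.differentiable_objective ρ, DTTQNN.integrable_norm_gradient_objective_sq ρ, ?_, ?_⟩
  · exact (mul_le_mul_of_nonneg_right (DTTQNN.one_add_logb_div_le (NeZero.ne n))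
      alpha_nonneg).trans (DTTQNN.le_integral_norm_gradient_objective_sq ρ)
  · exact hρ.integral_norm_gradient_objective_sq_le.trans (le_sub_iff_add_le.mpr card_add_one_le)
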